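/- Let $B_{TC^0}$ be the basic first-order theory for $TC^0$: the universal theory, in the language $L_{TC^0}$ with the relations $=,\le$ and function symbols for all $TC^0$ functions, that is axiomatized by Buss's $BASIC$ axioms, the defining axioms of $\dot-$ and $\lfloor x/2^y\rfloor$, and open bit comprehension and open minimization (induction) up to lengths for all the function symbols. For a set of sentences $\Gamma$, write $\Gamma\vdash\sigma$ if $\sigma$ is provable in first-order logic from $B_{TC^0}+\Gamma$ (outermost universal quantifiers are omitted). Let $\hat\Sigma^b_0=\hat\Pi^b_0$ be the class of sharply bounded formulas (all quantifiers of the form $Qx\le|t|$), and for $i>0$ let $\hat\Sigma^b_i$ ($\hat\Pi^b_i$) be the class of formulas consisting of $i$ alternating, possibly empty, blocks of bounded quantifiers, the first block being existential (universal), followed by a sharply bounded formula. Prefixes such as $\forall\exists$ and $\exists\forall$ denote blocks of unbounded quantifiers. Let $T^i_2$ and $S^i_2$ be $B_{TC^0}$ extended, for all $\psi\in\hat\Sigma^b_i$ (with parameters $\vec y$), by the induction axioms $$\psi(0,\vec y)\land\forall x\,(\psi(x,\vec y)\to\psi(x+1,\vec y))\to\forall x\,\psi(x,\vec y),$$ respectively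 by the polynomial induction axioms $$\psi(0,\vec y)\land\forall x\,(\psi(\lfloor x/2\rfloor,\vec y)\to\psi(x,\vec y))\to\forall x\,\psi(x,\vec y).$$ **Theorem 5.5.** Let $i>0$, let $T$ be a theory that is axiomatized over $B_{TC^0}$ by $\forall\exists\hat\Sigma^b_i$ sentences, and let $\varphi(x)$ be an $\exists\forall\hat\Pi^b_i$ formula. If $T+T^i_2$ (respectively, $T+S^i_2$) proves $\forall x\,\varphi(x)$, then there are $k\in\omega$ and $\hat\Pi^b_{i-1}$ formulas $\theta_1(x_0,x_1),\dots,\theta_k(x_0,\dots,x_k)$ such that $$T\vdash\varphi(x_0)\lor\exists y\,\theta_j(x_0,\dots,x_{j-1},y),\qquad j=1,\dots,k,\tag{5}$$ $$T\vdash\bigwedge_{j=1}^k\theta_j(x_0,\dots,x_j)\to\varphi(x_0)\lor\bigvee_{j,l=1}^k\bigl(x_l\prec x_j\land\theta_j(x_0,\dots,x_{j-1},x_l)\bigr),\tag{6}$$ where $y\prec x$ denotes $y<x$ (respectively, $|y|<|x|$). -/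

import Mathlib

open FirstOrder

namespace BoundedArith

open FirstOrder.Language

/-! ### The language of the base theory -/

/-- Function symbols for all `TC⁰` functions, presented as a function algebra.  The initial functions
are those of Buss's language together with `msp (x, i) = ⌊x / 2 ^ i⌋` and truncated subtraction; the
symbols are closed under composition, bit comprehension and sharply bounded minimization.
The presence of multiplication among the initial functions makes this closure all of `TC⁰`. -/
inductive TCFunc : ℕ → Type
  | zero : TCFunc 0
  | succ : TCFunc 1
  | add : TCFunc 2
  | mul : TCFunc 2
  | half : TCFunc 1
  | len : TCFunc 1
  | smash : TCFunc 2
  | msp : TCFunc 2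
  | monus : TCFunc 2
  /-- the projection `(y₀, …, yₙ₋₁) ↦ yᵢ` -/
  | proj {n : ℕ} (i : Fin n) : TCFunc n
  /-- the composition `y ↦ f (g₀ y, …, gₙ₋₁ y)` -/
  | comp {n m : ℕ} (f : TCFunc n) (g : Fin n → TCFunc m) : TCFunc m
  /-- `(a, y) ↦ ∑ {2 ^ i | i < |a|, f (i, y) ≠ 0}` -/
  | bits {n : ℕ} (f : TCFunc (n + 1)) : TCFunc (n + 1)
  /-- `(a, y) ↦` the least `i < |a|` with `f (i, y) ≠ 0`, and `|a|` if there is none -/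
  | least {n : ℕ} (f : TCFunc (n + 1)) : TCFunc (n + 1)

/-- The only relation symbol besides equality is `≤`. -/
inductive TCRel : ℕ → Type
  | le : TCRel 2

/-- The language of the base theory. -/
abbrev LTC : FirstOrder.Language.{0, 0} := ⟨TCFunc, TCRel⟩

section Terms

variable {α : Type}

/-- A function symbol as a function symbol of the language. -/
abbrev fn {n : ℕ} (f : TCFunc n) (ts : Fin n → LTC.Term α) : LTC.Term α :=
  Term.func (L := LTC) f ts

instance : Zero (LTC.Term α) := ⟨fn TCFunc.zero ![]⟩
instance : Add (LTC.Term α) := ⟨fun s t => fn TCFunc.add ![s, t]⟩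
instance : Mul (LTC.Term α) := ⟨fun s t => fn TCFunc.mul ![s, t]⟩

def S (t : LTC.Term α) : LTC.Term α := fn TCFunc.succ ![t]
def half (t : LTC.Term α) : LTC.Term α := fn TCFunc.half ![t]
def len (t : LTC.Term α) : LTC.Term α := fn TCFunc.len ![t]
def smash (s t : LTC.Term α) : LTC.Term α := fn TCFunc.smash ![s, t]
def msp (s t : LTC.Term α) : LTC.Term α := fn TCFunc.msp ![s, t]
def monus (s t : LTC.Term α) : LTC.Term α := fn TCFunc.monus ![s, t]

/-- The numeral `2`. -/
def two : LTC.Term α := S (S 0)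

/-- `s = t` -/
def eqF (s t : LTC.Term α) : LTC.Formula α := Term.equal s t

/-- `s ≤ t` -/
def leF (s t : LTC.Term α) : LTC.Formula α := Relations.formula₂ (L := LTC) TCRel.le s t

/-- `s < t` -/
def ltF (s t : LTC.Term α) : LTC.Formula α := leF s t ⊓ ∼(eqF s t)

/-- `|s| < |t|` -/
def lenLtF (s t : LTC.Term α) : LTC.Formula α := ltF (len s) (len t)

/-- The bit of `s` at position `t` is `1`, i.e. `⌊s / 2 ^ t⌋` is odd. -/
def bitF (s t : LTC.Term α) : LTC.Formula α := eqF (msp s t) (S (two * half (msp s t)))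

end Terms

/-! ### Quantifying free variables of formulas -/

/-- `∀ y, φ (x₀, …, xₙ₋₁, y)` -/
noncomputable def allLast {n : ℕ} (φ : LTC.Formula (Fin (n + 1))) : LTC.Formula (Fin n) :=
  Formula.iAlls Unit
    (φ.relabel (Fin.lastCases (motive := fun _ => Fin n ⊕ Unit) (Sum.inr ()) Sum.inl))

/-- `∃ y, φ (x₀, …, xₙ₋₁, y)` -/
noncomputable def exLast {n : ℕ} (φ : LTC.Formula (Fin (n + 1))) : LTC.Formula (Fin n) :=
  Formula.iExs Unit
    (φ.relabel (Fin.lastCases (motive := fun _ => Fin n ⊕ Unit) (Sum.inr ()) Sum.inl))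

/-- The universal closure of a formula. -/
noncomputable def univClosure {n : ℕ} (φ : LTC.Formula (Fin n)) : LTC.Sentence :=
  Formula.iAlls (Fin n) (φ.relabel (Sum.inr : Fin n → Empty ⊕ Fin n))

/-! ### The base theory -/

/-- The open axioms for the initial functions: Buss's thirty-two axioms `BASIC`, followed by
axioms for truncated subtraction and for `msp`. -/
def initialAxiomsOf {α : Type} (x y z u : LTC.Term α) : List (LTC.Formula α) :=
  [ leF y x ⟹ leF y (S x),
    ∼(eqF x (S x)),
    leF 0 x,
    (leF x y ⊓ ∼(eqF x y)) ⇔ leF (S x) y,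
    ∼(eqF x 0) ⟹ ∼(eqF (two * x) 0),
    leF y x ⊔ leF x y,
    (leF x y ⊓ leF y x) ⟹ eqF x y,
    (leF x y ⊓ leF y z) ⟹ leF x z,
    eqF (len 0) 0,
    ∼(eqF x 0) ⟹ (eqF (len (two * x)) (S (len x)) ⊓ eqF (len (S (two * x))) (S (len x))),
    eqF (len (S 0)) (S 0),
    leF x y ⟹ leF (len x) (len y),
    eqF (len (smash x y)) (S (len x * len y)),
    eqF (smash 0 y) (S 0),
    ∼(eqF x 0) ⟹ (eqF (smash (S 0) (two * x)) (two * smash (S 0) x) ⊓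
      eqF (smash (S 0) (S (two * x))) (two * smash (S 0) x)),
    eqF (smash x y) (smash y x),
    eqF (len x) (len y) ⟹ eqF (smash x z) (smash y z),
    eqF (len x) (len u + len z) ⟹ eqF (smash x y) (smash u y * smash z y),
    leF x (x + y),
    (leF x y ⊓ ∼(eqF x y)) ⟹ (leF (S (two * x)) (two * y) ⊓ ∼(eqF (S (two * x)) (two * y))),
    eqF (x + y) (y + x),
    eqF (x + 0) x,
    eqF (x + S y) (S (x + y)),
    eqF ((x + y) + z) (x + (y + z)),
    leF (x + y) (x + z) ⇔ leF y z,
    eqF (x * 0) 0,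
    eqF (x * S y) (x * y + x),
    eqF (x * y) (y * x),
    eqF (x * (y + z)) (x * y + x * z),
    leF (S 0) x ⟹ (leF (x * y) (x * z) ⇔ leF y z),
    ∼(eqF x 0) ⟹ eqF (len x) (S (len (half x))),
    eqF x (half y) ⇔ (eqF (two * x) y ⊔ eqF (S (two * x)) y),
    leF y x ⟹ eqF (monus x y + y) x,
    leF x y ⟹ eqF (monus x y) 0,
    eqF (msp x 0) x,
    eqF (msp x (S y)) (half (msp x y)),
    leF (len x) y ⟹ eqF (msp x y) 0 ]

/-- The open axioms for the initial functions, in four variables. -/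
def initialAxioms : List (LTC.Formula (Fin 4)) :=
  initialAxiomsOf (Term.var 0) (Term.var 1) (Term.var 2) (Term.var 3)

/-- The axioms of the base theory (before taking universal closures).  In the axioms for `bits f` and
`least f`, the variables are `a` (index `0`), `i` (index `1`), and the parameters `y`. -/
inductive IsBaseAxiom : ∀ {n : ℕ}, LTC.Formula (Fin n) → Prop
  | initial {φ : LTC.Formula (Fin 4)} (h : φ ∈ initialAxioms) : IsBaseAxiom φ
  | proj {n : ℕ} (i : Fin n) :
      IsBaseAxiom (eqF (fn (TCFunc.proj i) Term.var) (Term.var i))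
  | comp {n m : ℕ} (f : TCFunc n) (g : Fin n → TCFunc m) :
      IsBaseAxiom (eqF (fn (TCFunc.comp f g) Term.var) (fn f fun j => fn (g j) Term.var))
  /-- `|bits f (a, y)| ≤ |a|` -/
  | bits_len {n : ℕ} (f : TCFunc (n + 1)) :
      IsBaseAxiom (n := n + 2)
        (leF (len (fn (TCFunc.bits f)
            (Fin.cons (Term.var 0) fun j : Fin n => Term.var j.succ.succ)))
          (len (Term.var 0)))
  /-- for `i < |a|`, the `i`-th bit of `bits f (a, y)` is `1` iff `f (i, y) ≠ 0` -/
  | bits_bit {n : ℕ} (f : TCFunc (n + 1)) :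
      IsBaseAxiom (n := n + 2)
        (ltF (Term.var 1) (len (Term.var 0)) ⟹
          (bitF (fn (TCFunc.bits f)
              (Fin.cons (Term.var 0) fun j : Fin n => Term.var j.succ.succ)) (Term.var 1) ⇔
            ∼(eqF (fn f (Fin.cons (Term.var 1) fun j : Fin n => Term.var j.succ.succ)) 0)))
  /-- `least f (a, y) ≤ |a|` -/
  | least_le {n : ℕ} (f : TCFunc (n + 1)) :
      IsBaseAxiom (n := n + 2)
        (leF (fn (TCFunc.least f)
            (Fin.cons (Term.var 0) fun j : Fin n => Term.var j.succ.succ))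
          (len (Term.var 0)))
  /-- if `i = least f (a, y) < |a|`, then `f (i, y) ≠ 0` -/
  | least_spec {n : ℕ} (f : TCFunc (n + 1)) :
      IsBaseAxiom (n := n + 2)
        (ltF (fn (TCFunc.least f)
            (Fin.cons (Term.var 0) fun j : Fin n => Term.var j.succ.succ))
          (len (Term.var 0)) ⟹
          ∼(eqF (fn f (Fin.cons
              (fn (TCFunc.least f)
                (Fin.cons (Term.var 0) fun j : Fin n => Term.var j.succ.succ))
              fun j : Fin n => Term.var j.succ.succ)) 0))
  /-- if `i < least f (a, y)`, then `f (i, y) = 0` -/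
  | least_min {n : ℕ} (f : TCFunc (n + 1)) :
      IsBaseAxiom (n := n + 2)
        (ltF (Term.var 1) (fn (TCFunc.least f)
            (Fin.cons (Term.var 0) fun j : Fin n => Term.var j.succ.succ)) ⟹
          eqF (fn f (Fin.cons (Term.var 1) fun j : Fin n => Term.var j.succ.succ)) 0)

/-- The basic theory `B` for `TC⁰`: the universal theory axiomatized by `BASIC`, open
bit comprehension, and open minimization (equivalently, open induction) up to lengths, for all
function symbols.  Every open formula is equivalent to one of the form `f (y) ≠ 0`; so this is the
universal presentation of the closure of `BASIC + open-LIND` under the `Δᵇ₁` bit comprehension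
rule, expanded by symbols for its `Σᵇ₁`-definable functions. -/
def baseTheory : LTC.Theory :=
  {σ | ∃ (n : ℕ) (φ : LTC.Formula (Fin n)), IsBaseAxiom φ ∧ σ = univClosure φ}

/-- `Proves Γ σ` says that `σ` is provable in `B + Γ`: it belongs to the least set of sentences that
includes `B`, `Γ` and the logically valid sentences, and is closed under modus ponens. -/
inductive Proves (Γ : LTC.Theory) : LTC.Sentence → Prop
  | base {σ : LTC.Sentence} (h : σ ∈ baseTheory) : Proves Γ σ
  | hyp {σ : LTC.Sentence} (h : σ ∈ Γ) : Proves Γ σ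
  | valid {σ : LTC.Sentence} (h : (∅ : LTC.Theory) ⊨ᵇ σ) : Proves Γ σ
  | mp {σ τ : LTC.Sentence} (h₁ : Proves Γ (σ ⟹ τ)) (h₂ : Proves Γ σ) : Proves Γ τ

/-- The theory `B + T` has an axiomatization over `B` by sentences in the class `K`. -/
def IsAxiomatizedBy (K : LTC.Sentence → Prop) (T : LTC.Theory) : Prop :=
  ∃ Γ : LTC.Theory, (∀ σ ∈ Γ, K σ) ∧ ∀ σ : LTC.Sentence, Proves T σ ↔ Proves Γ σ

/-! ### Classes of formulas -/

section Classes

variable {α : Type}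

/-- A term, regarded as a term with one more bound variable (which does not occur in it). -/
def liftTerm {n : ℕ} (t : LTC.Term (α ⊕ Fin n)) : LTC.Term (α ⊕ Fin (n + 1)) :=
  t.relabel (Sum.map id Fin.castSucc)

/-- `x ≤ t`, where `x` is the last of the bound variables and does not occur in `t`. -/
def lastLe {n : ℕ} (t : LTC.Term (α ⊕ Fin n)) : LTC.BoundedFormula α (n + 1) :=
  Relations.boundedFormula₂ (L := LTC) TCRel.le (Term.var (Sum.inr (Fin.last n))) (liftTerm t)

/-- `∀ x ≤ t, φ` -/
def bdAll {n : ℕ} (t : LTC.Term (α ⊕ Fin n)) (φ : LTC.BoundedFormula α (n + 1)) :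
    LTC.BoundedFormula α n :=
  (lastLe t ⟹ φ).all

/-- `∃ x ≤ t, φ` -/
def bdEx {n : ℕ} (t : LTC.Term (α ⊕ Fin n)) (φ : LTC.BoundedFormula α (n + 1)) :
    LTC.BoundedFormula α n :=
  (lastLe t ⊓ φ).ex

/-- Sharply bounded formulas: built from atomic formulas by Boolean connectives (all of which are
expressed by `⊥` and implication) and quantifiers bounded by lengths of terms. -/
inductive IsSharplyBounded : ∀ {n : ℕ}, LTC.BoundedFormula α n → Prop
  | falsum {n : ℕ} : IsSharplyBounded (BoundedFormula.falsum : LTC.BoundedFormula α n)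
  | atomic {n : ℕ} {φ : LTC.BoundedFormula α n} (h : φ.IsAtomic) : IsSharplyBounded φ
  | imp {n : ℕ} {φ ψ : LTC.BoundedFormula α n} (h₁ : IsSharplyBounded φ)
      (h₂ : IsSharplyBounded ψ) : IsSharplyBounded (φ ⟹ ψ)
  | all {n : ℕ} (t : LTC.Term (α ⊕ Fin n)) {φ : LTC.BoundedFormula α (n + 1)}
      (h : IsSharplyBounded φ) : IsSharplyBounded (bdAll (len t) φ)
  | ex {n : ℕ} (t : LTC.Term (α ⊕ Fin n)) {φ : LTC.BoundedFormula α (n + 1)}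
      (h : IsSharplyBounded φ) : IsSharplyBounded (bdEx (len t) φ)

/-- A class of formulas in free variables from `α`. -/
abbrev FormulaClass (α : Type) := ∀ n : ℕ, LTC.BoundedFormula α n → Prop

/-- A (possibly empty) block of bounded existential quantifiers followed by a formula in `K`. -/
inductive BdExBlock (K : FormulaClass α) : FormulaClass α
  | base {n : ℕ} {φ : LTC.BoundedFormula α n} (h : K n φ) : BdExBlock K n φ
  | ex {n : ℕ} (t : LTC.Term (α ⊕ Fin n)) {φ : LTC.BoundedFormula α (n + 1)}
      (h : BdExBlock K (n + 1) φ) : BdExBlock K n (bdEx t φ)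

/-- A (possibly empty) block of bounded universal quantifiers followed by a formula in `K`. -/
inductive BdAllBlock (K : FormulaClass α) : FormulaClass α
  | base {n : ℕ} {φ : LTC.BoundedFormula α n} (h : K n φ) : BdAllBlock K n φ
  | all {n : ℕ} (t : LTC.Term (α ⊕ Fin n)) {φ : LTC.BoundedFormula α (n + 1)}
      (h : BdAllBlock K (n + 1) φ) : BdAllBlock K n (bdAll t φ)

/-- A (possibly empty) block of unbounded existential quantifiers followed by a formula in `K`. -/
inductive ExBlock (K : FormulaClass α) : FormulaClass α
  | base {n : ℕ} {φ : LTC.BoundedFormula α n} (h : K n φ) : ExBlock K n φ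
  | ex {n : ℕ} {φ : LTC.BoundedFormula α (n + 1)} (h : ExBlock K (n + 1) φ) : ExBlock K n φ.ex

/-- A (possibly empty) block of unbounded universal quantifiers followed by a formula in `K`. -/
inductive AllBlock (K : FormulaClass α) : FormulaClass α
  | base {n : ℕ} {φ : LTC.BoundedFormula α n} (h : K n φ) : AllBlock K n φ
  | all {n : ℕ} {φ : LTC.BoundedFormula α (n + 1)} (h : AllBlock K (n + 1) φ) :
      AllBlock K n φ.all

mutual

/-- The strict class `Σ̂ᵢ`: `i` alternating blocks of bounded quantifiers, the first one being
existential, followed by a sharply bounded formula. -/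
def SigmaHat : ℕ → FormulaClass α
  | 0 => fun _ φ => IsSharplyBounded φ
  | i + 1 => BdExBlock (PiHat i)

/-- The strict class `Π̂ᵢ`: `i` alternating blocks of bounded quantifiers, the first one being
universal, followed by a sharply bounded formula. -/
def PiHat : ℕ → FormulaClass α
  | 0 => fun _ φ => IsSharplyBounded φ
  | i + 1 => BdAllBlock (SigmaHat i)

end

end Classes

/-- `φ` is a `Π̂ᵢ` formula. -/
def IsPiHat {α : Type} (i : ℕ) (φ : LTC.Formula α) : Prop := PiHat i 0 φ

/-- `φ` is a `Σ̂ᵢ` formula. -/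
def IsSigmaHat {α : Type} (i : ℕ) (φ : LTC.Formula α) : Prop := SigmaHat i 0 φ

/-- `φ` is an `∃∀Π̂ᵢ` formula. -/
def IsExAllPiHat {α : Type} (i : ℕ) (φ : LTC.Formula α) : Prop := ExBlock (AllBlock (PiHat i)) 0 φ

/-- `σ` is an `∀∃Σ̂ᵢ` sentence. -/
def IsAllExSigmaHat (i : ℕ) (σ : LTC.Sentence) : Prop := AllBlock (ExBlock (SigmaHat i)) 0 σ

/-! ### Induction axioms -/

/-- The formula `φ (y, t (x))` obtained from `φ (y, x)`, where `x` is the last variable. -/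
def substLast {n : ℕ} (φ : LTC.Formula (Fin (n + 1)))
    (t : LTC.Term (Fin (n + 1)) → LTC.Term (Fin (n + 1))) : LTC.Formula (Fin (n + 1)) :=
  BoundedFormula.subst φ
    (Fin.snoc (fun i : Fin n => Term.var i.castSucc) (t (Term.var (Fin.last n))) :
      Fin (n + 1) → LTC.Term (Fin (n + 1)))

/-- The formula `φ (y, 0)` obtained from `φ (y, x)`, where `x` is the last variable. -/
def atZero {n : ℕ} (φ : LTC.Formula (Fin (n + 1))) : LTC.Formula (Fin n) :=
  BoundedFormula.subst φ (Fin.snoc (fun i : Fin n => Term.var i) 0 : Fin (n + 1) → LTC.Term (Fin n))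

/-- The induction axiom for `φ (y, x)`, with `x` the last variable and parameters `y`:
`∀ y (φ (y, 0) ∧ ∀ x (φ (y, x) → φ (y, x + 1)) → ∀ x φ (y, x))`. -/
noncomputable def indAxiom {n : ℕ} (φ : LTC.Formula (Fin (n + 1))) : LTC.Sentence :=
  univClosure ((atZero φ ⊓ allLast (φ ⟹ substLast φ S)) ⟹ allLast φ)

/-- The polynomial induction axiom for `φ (y, x)`, with `x` the last variable and parameters `y`:
`∀ y (φ (y, 0) ∧ ∀ x (φ (y, ⌊x / 2⌋) → φ (y, x)) → ∀ x φ (y, x))`. -/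
noncomputable def pindAxiom {n : ℕ} (φ : LTC.Formula (Fin (n + 1))) : LTC.Sentence :=
  univClosure ((atZero φ ⊓ allLast (substLast φ half ⟹ φ)) ⟹ allLast φ)

/-- Axioms of `Tⁱ₂` over `B`: induction for `Σ̂ᵢ` formulas. -/
def T2 (i : ℕ) : LTC.Theory :=
  {σ | ∃ (n : ℕ) (φ : LTC.Formula (Fin (n + 1))), IsSigmaHat i φ ∧ σ = indAxiom φ}

/-- Axioms of `Sⁱ₂` over `B`: polynomial induction for `Σ̂ᵢ` formulas. -/
def S2 (i : ℕ) : LTC.Theory :=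
  {σ | ∃ (n : ℕ) (φ : LTC.Formula (Fin (n + 1))), IsSigmaHat i φ ∧ σ = pindAxiom φ}

/-! ### The witnessing formulas

The formulas `θ₁ (x₀, x₁), …, θₖ (x₀, …, xₖ)` are indexed by `j : Fin k`, so that `θ j` stands for
`θ_{j+1} (x₀, …, x_{j+1})`. -/

/-- `φ (x₀) ∨ ∃ y, θ_{j+1} (x₀, …, xⱼ, y)` -/
noncomputable def totalF (φ : LTC.Formula (Fin 1)) {j : ℕ} (θ : LTC.Formula (Fin (j + 2))) :
    LTC.Formula (Fin (j + 1)) :=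
  φ.relabel (fun _ => (0 : Fin (j + 1))) ⊔ exLast θ

/-- `θ_{j+1} (x₀, …, x_{j+1})` as a formula in `x₀, …, xₖ` -/
def thetaF {k : ℕ} (j : Fin k) (θ : LTC.Formula (Fin (j.val + 2))) : LTC.Formula (Fin (k + 1)) :=
  θ.relabel (Fin.castLE (by omega) : Fin (j.val + 2) → Fin (k + 1))

/-- `θ_{j+1} (x₀, …, xⱼ, x_{l+1})` as a formula in `x₀, …, xₖ` -/
def thetaAtF {k : ℕ} (j l : Fin k) (θ : LTC.Formula (Fin (j.val + 2))) :
    LTC.Formula (Fin (k + 1)) :=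
  θ.relabel (Fin.snoc (Fin.castLE (by omega) : Fin (j.val + 1) → Fin (k + 1)) l.succ :
    Fin (j.val + 2) → Fin (k + 1))

/-- With `≺` given by `prec`, the formula
`⋀ⱼ θⱼ (x₀, …, xⱼ) → φ (x₀) ∨ ⋁ⱼ ⋁ₗ (xₗ ≺ xⱼ ∧ θⱼ (x₀, …, xⱼ₋₁, xₗ))`, where `j, l = 1, …, k`. -/
noncomputable def descentF {k : ℕ}
    (prec : LTC.Term (Fin (k + 1)) → LTC.Term (Fin (k + 1)) → LTC.Formula (Fin (k + 1)))
    (φ : LTC.Formula (Fin 1)) (θ : ∀ j : Fin k, LTC.Formula (Fin (j.val + 2))) :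
    LTC.Formula (Fin (k + 1)) :=
  Formula.iInf (fun j : Fin k => thetaF j (θ j)) ⟹
    (φ.relabel (fun _ => (0 : Fin (k + 1))) ⊔
      Formula.iSup (fun j : Fin k => Formula.iSup (fun l : Fin k =>
        prec (Term.var l.succ) (Term.var j.succ) ⊓ thetaAtF j l (θ j))))

end BoundedArith

open FirstOrder

namespace BoundedArith

open FirstOrder.Language

/-! ### Provability and semantic consequence -/

-- The proof is a Herbrand-style argument by Skolem names, carried out on models. Put `j = i - 1`.
-- Introduce a name (an element of `Wit`) for every `Π̂ⱼ` formula `θ (x₀, y, z)` that is total,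
-- meaning that `φ (x₀) ∨ ∃ z θ` holds in all models of `B + T`; the arguments `y` are themselves
-- names. A valuation of the names is minimal if each name satisfies its formula and no value of any
-- name that satisfies the same formula is `≺` it.
--
-- The core claim is that no minimal valuation refutes `φ` at `x₀`. Let `H` be the set of values.
-- Each property of `H` comes from the totality of a suitable formula: `z = f (y)` and `z = x₀` make
-- `H` a substructure containing `x₀`, so `H ⊨ B` because `B` is universal; `∃ z χ → χ (z)` makes
-- `H` absolute for `Π̂ⱼ` formulas; the matrices of the axioms of `T` make `H ⊨ T`; `Θ (z) ∨ z = w`,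
-- together with minimality, gives `H` minimization for `Π̂ⱼ` sets, hence `Tⁱ₂` or `Sⁱ₂`. Thus `H ⊨
-- φ (x₀)`. But `¬φ` is equivalent to an `∀∃Σ̂ᵢ` formula and `φ ∨ ¬φ` is valid, so its matrix is
-- total too, and `H ⊨ ¬φ (x₀)`, a contradiction.
--
-- By compactness, finitely many of the conditions defining a minimal valuation refuting `φ` are
-- already inconsistent with `B + T`. List the names involved so that arguments come first; their
-- formulas are `θ₁, …, θₖ`. Their totality is (5), and the inconsistency is (6).
--
-- The arithmetic in `B` supplies two ingredients. A pairing function contracts blocks of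
-- existential quantifiers (`SigmaHat.exists_contraction`, `ExBlock.exists_contraction`). Induction
-- for `∃ z ≤ t θ` reduces to minimization over numbers that code an argument together with its
-- witness (`exists_of_minimal`, `exists_of_len_minimal`).

theorem Proves.realize {Γ : LTC.Theory} {σ : LTC.Sentence} (h : Proves Γ σ) (M : Type)
    [LTC.Structure M] [Nonempty M] (hB : M ⊨ baseTheory) (hΓ : M ⊨ Γ) : M ⊨ σ := by
  induction h with
  | base h => exact hB.realize_of_mem _ h
  | hyp h => exact hΓ.realize_of_mem _ h
  | valid h =>
    have : M ⊨ (∅ : LTC.Theory) := ⟨fun _ h => h.elim⟩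
    exact h.realize_sentence M
  | mp _ _ h₁ h₂ => exact h₁ h₂

/-- The finitely many hypotheses are discharged one at a time: if `τ` and the rest entail `σ`, the
rest entail `τ ⟹ σ`, and modus ponens removes `τ`. -/
theorem Proves.of_finset {Γ : LTC.Theory} (F : Finset LTC.Sentence) :
    ∀ {σ : LTC.Sentence}, (∀ τ ∈ F, Proves Γ τ) → (F : LTC.Theory) ⊨ᵇ σ → Proves Γ σ := by
  classical
  induction F using Finset.induction_on with
  | empty => exact fun _ h => .valid (by simpa using h)
  | insert τ F _ ih =>
    intro σ hF h
    refine .mp (ih (fun τ' h' => hF τ' (Finset.mem_insert_of_mem h')) ?_)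
      (hF τ (Finset.mem_insert_self _ _))
    rw [Theory.models_sentence_iff]
    intro M hτ
    have : (M : Type) ⊨ ((insert τ F : Finset LTC.Sentence) : LTC.Theory) := by
      rw [Finset.coe_insert, Theory.model_insert_iff]
      exact ⟨hτ, inferInstance⟩
    exact h.realize_sentence M

/-- Compactness reduces entailment to finitely many axioms. All later arguments are semantic and
return to provability through this equivalence. -/
theorem proves_iff {Γ : LTC.Theory} {σ : LTC.Sentence} :
    Proves Γ σ ↔ ∀ (M : Type) [LTC.Structure M] [Nonempty M], M ⊨ baseTheory → M ⊨ Γ → M ⊨ σ := by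
  refine ⟨fun h M _ _ => h.realize M, fun h => ?_⟩
  have h' : (baseTheory ∪ Γ) ⊨ᵇ σ := by
    rw [Theory.models_sentence_iff]
    intro M
    exact h M (Theory.Model.mono (M.is_model) Set.subset_union_left)
      (Theory.Model.mono (M.is_model) Set.subset_union_right)
  obtain ⟨F, hF, hσ⟩ := Theory.models_iff_finset_models.1 h'
  exact Proves.of_finset F (fun τ hτ => (hF hτ).elim .base .hyp) hσ

theorem elim_lastCases {M : Type} {n : ℕ} (v : Fin n → M) (i : Unit → M) :
    (fun a => Sum.elim v i a) ∘
      (Fin.lastCases (motive := fun _ => Fin n ⊕ Unit) (Sum.inr ()) Sum.inl) =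
      (Fin.snoc v (i ()) : Fin (n + 1) → M) := by
  funext j
  refine Fin.lastCases ?_ (fun j => ?_) j <;> simp

section Realize

variable {M : Type} [LTC.Structure M]

@[simp]
theorem realize_univClosure {n : ℕ} {φ : LTC.Formula (Fin n)} :
    M ⊨ univClosure φ ↔ ∀ v : Fin n → M, φ.Realize v := by
  simp only [univClosure, Sentence.Realize, Formula.realize_iAlls, Formula.realize_relabel]
  rfl

@[simp]
theorem realize_allLast {n : ℕ} {φ : LTC.Formula (Fin (n + 1))} {v : Fin n → M} :
    (allLast φ).Realize v ↔ ∀ y : M, φ.Realize (Fin.snoc v y : Fin (n + 1) → M) := by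
  simp only [allLast, Formula.realize_iAlls, Formula.realize_relabel, elim_lastCases]
  exact ⟨fun h y => h fun _ => y, fun h i => h (i ())⟩

@[simp]
theorem realize_exLast {n : ℕ} {φ : LTC.Formula (Fin (n + 1))} {v : Fin n → M} :
    (exLast φ).Realize v ↔ ∃ y : M, φ.Realize (Fin.snoc v y : Fin (n + 1) → M) := by
  simp only [exLast, Formula.realize_iExs, Formula.realize_relabel, elim_lastCases]
  exact ⟨fun ⟨i, h⟩ => ⟨i (), h⟩, fun ⟨y, h⟩ => ⟨fun _ => y, h⟩⟩

end Realize

/-! ### Compactness for sets of formulas -/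

/-- Ordinary compactness after the free variables have been turned into new constants. -/
theorem exists_finset_of_not_realize {α : Type} (T : LTC.Theory) (Δ : Set (LTC.Formula α))
    (h : ∀ (M : Type) [LTC.Structure M] [Nonempty M] (v : α → M), M ⊨ T →
      ∃ δ ∈ Δ, ¬ δ.Realize v) :
    ∃ Δ₀ : Finset (LTC.Formula α), (Δ₀ : Set (LTC.Formula α)) ⊆ Δ ∧
      ∀ (M : Type) [LTC.Structure M] [Nonempty M] (v : α → M), M ⊨ T →
        ∃ δ ∈ Δ₀, ¬ δ.Realize v := by
  classical
  by_contra! hcon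
  let Θ : Set (LTC.Formula α) → (LTC[[α]]).Theory := fun Δ' =>
    (LTC.lhomWithConstants α).onTheory T ∪ Formula.equivSentence '' Δ'
  have hsat : (Θ Δ).IsSatisfiable := by
    rw [Theory.isSatisfiable_iff_isFinitelySatisfiable]
    intro F hF
    -- `Formula.equivSentence` is a bijection, so the part of `F` that comes from `Δ` can be pulled
    -- back to formulas.
    let Δ₀ : Finset (LTC.Formula α) :=
      (F.image Formula.equivSentence.symm).filter fun δ => δ ∈ Δ
    obtain ⟨M, _, _, v, hT, hv⟩ := hcon Δ₀ (by intro δ hδ; simp [Δ₀] at hδ; exact hδ.2)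
    let _ : (constantsOn α).Structure M := constantsOn.structure v
    have : M ⊨ Θ Δ₀ := by
      refine Theory.model_union_iff.2 ⟨(LHom.onTheory_model _ _).2 hT, ⟨?_⟩⟩
      rintro _ ⟨δ, hδ, rfl⟩
      exact (Formula.realize_equivSentence M δ).2 (hv δ hδ)
    refine (Theory.Model.isSatisfiable (T := Θ Δ₀) M).mono fun σ hσ => ?_
    rcases hF hσ with h1 | ⟨δ, hδ, rfl⟩
    · exact Or.inl h1
    · refine Or.inr ⟨δ, ?_, rfl⟩
      simp only [Δ₀, Finset.coe_filter, Finset.mem_image]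
      exact ⟨⟨_, hσ, by simp⟩, hδ⟩
  obtain ⟨N⟩ := hsat
  let _ : LTC.Structure N := (LTC.lhomWithConstants α).reduct N
  have : (LTC.lhomWithConstants α).IsExpansionOn N := LHom.isExpansionOn_reduct _ _
  obtain ⟨hT, hΔ⟩ := Theory.model_union_iff.1 N.is_model
  obtain ⟨δ, hδ, hn⟩ := h N (fun a => (LTC.con a : N)) ((LHom.onTheory_model _ _).1 hT)
  exact hn ((Formula.realize_equivSentence N δ).1 (hΔ.realize_of_mem _ ⟨δ, hδ, rfl⟩))

theorem vec_eq_one {M : Type} (v : Fin 1 → M) : v = ![v 0] := by funext i; fin_cases i; rfl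

theorem vec_eq_two {M : Type} (v : Fin 2 → M) : v = ![v 0, v 1] := by funext i; fin_cases i <;> rfl

/-! ### The operations of a structure -/

section Operations

variable {M : Type} [LTC.Structure M]

/-- The interpretation of a function symbol. -/
abbrev app {n : ℕ} (f : TCFunc n) (v : Fin n → M) : M := Structure.funMap (L := LTC) f v

abbrev zeroOf : Zero M := ⟨app TCFunc.zero ![]⟩
abbrev oneOf : One M := ⟨app TCFunc.succ ![app TCFunc.zero ![] ]⟩
abbrev addOf : Add M := ⟨fun a b => app TCFunc.add ![a, b]⟩
abbrev mulOf : Mul M := ⟨fun a b => app TCFunc.mul ![a, b]⟩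
abbrev leOf : LE M := ⟨fun a b => Structure.RelMap (L := LTC) TCRel.le ![a, b]⟩

def mlen (a : M) : M := app TCFunc.len ![a]
def mhalf (a : M) : M := app TCFunc.half ![a]
def msucc (a : M) : M := app TCFunc.succ ![a]
def msmash (a b : M) : M := app TCFunc.smash ![a, b]
def mmsp (a b : M) : M := app TCFunc.msp ![a, b]
def mmonus (a b : M) : M := app TCFunc.monus ![a, b]

attribute [local instance] zeroOf oneOf addOf mulOf leOf

variable {α : Type} {v : α → M} {s t : LTC.Term α}

@[simp] theorem realize_zero : (0 : LTC.Term α).realize v = 0 := by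
  change app TCFunc.zero _ = app TCFunc.zero _
  congr 1; exact Subsingleton.elim _ _

theorem vec_two (s t : LTC.Term α) (v : α → M) :
    (fun i => (![s, t] i).realize v) = ![s.realize v, t.realize v] := by
  funext i; fin_cases i <;> rfl

theorem vec_one (s : LTC.Term α) (v : α → M) :
    (fun i => (![s] i).realize v) = ![s.realize v] := by
  funext i; fin_cases i; rfl

@[simp] theorem realize_fn {n : ℕ} (f : TCFunc n) (ts : Fin n → LTC.Term α) :
    (fn f ts).realize v = app f fun i => (ts i).realize v := rfl
@[simp] theorem realize_add : (s + t).realize v = s.realize v + t.realize v :=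
  congrArg (app TCFunc.add) (vec_two s t v)
@[simp] theorem realize_mul : (s * t).realize v = s.realize v * t.realize v :=
  congrArg (app TCFunc.mul) (vec_two s t v)
@[simp] theorem realize_S : (S t).realize v = msucc (t.realize v) :=
  congrArg (app TCFunc.succ) (vec_one t v)
@[simp] theorem realize_half : (half t).realize v = mhalf (t.realize v) :=
  congrArg (app TCFunc.half) (vec_one t v)
@[simp] theorem realize_len : (len t).realize v = mlen (t.realize v) :=
  congrArg (app TCFunc.len) (vec_one t v)
@[simp] theorem realize_smash : (smash s t).realize v = msmash (s.realize v) (t.realize v) :=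
  congrArg (app TCFunc.smash) (vec_two s t v)
@[simp] theorem realize_msp : (msp s t).realize v = mmsp (s.realize v) (t.realize v) :=
  congrArg (app TCFunc.msp) (vec_two s t v)
@[simp] theorem realize_monus : (monus s t).realize v = mmonus (s.realize v) (t.realize v) :=
  congrArg (app TCFunc.monus) (vec_two s t v)
@[simp] theorem realize_two : (two : LTC.Term α).realize v = msucc (msucc 0) := by simp [two]

/-- `1 # x = 2 ^ |x|` -/
def mpow (x : M) : M := msmash 1 x

/-- The term `1 # t`. -/
def powT {α : Type} (t : LTC.Term α) : LTC.Term α := smash (S 0) t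

@[simp] theorem realize_powT {α : Type} {v : α → M} {t : LTC.Term α} :
    (powT t).realize v = mpow (t.realize v) := by
  rw [powT, realize_smash, realize_S, realize_zero]; rfl

/-- The components of the pair coded by `w`: if `q = ⌊w / 2 ^ ⌊|w| / 2⌋⌋`, then
`w = q * 2 ^ (|q| - 1) + msnd w` and `q = 2 ^ (|q| - 1) + mfst w`. -/
def mfst (w : M) : M :=
  mmonus (mmsp w (mhalf (mlen w))) (mpow (mhalf (mmsp w (mhalf (mlen w)))))

def msnd (w : M) : M :=
  mmonus w (mmsp w (mhalf (mlen w)) * mpow (mhalf (mmsp w (mhalf (mlen w)))))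

def fstT {α : Type} (t : LTC.Term α) : LTC.Term α :=
  monus (msp t (half (len t))) (powT (half (msp t (half (len t)))))

def sndT {α : Type} (t : LTC.Term α) : LTC.Term α :=
  monus t (msp t (half (len t)) * powT (half (msp t (half (len t)))))

@[simp] theorem realize_fstT {α : Type} {v : α → M} {t : LTC.Term α} :
    (fstT t).realize v = mfst (t.realize v) := by simp [fstT, mfst]

@[simp] theorem realize_sndT {α : Type} {v : α → M} {t : LTC.Term α} :
    (sndT t).realize v = msnd (t.realize v) := by simp [sndT, msnd]

@[simp] theorem realize_eqF : (eqF s t).Realize v ↔ s.realize v = t.realize v :=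
  Formula.realize_equal
@[simp] theorem realize_leF : (leF s t).Realize v ↔ s.realize v ≤ t.realize v := by
  rw [leF, Formula.realize_rel₂]; rfl
theorem realize_ltF_raw :
    (ltF s t).Realize v ↔ s.realize v ≤ t.realize v ∧ s.realize v ≠ t.realize v := by
  simp [ltF]

/-- All axioms for `bits` and `least` apply a symbol to one term followed by the parameters, in an
environment ordered as `a`, `i`, parameters. -/
theorem realize_cons_param {n : ℕ} (f : TCFunc (n + 1)) (s : LTC.Term (Fin (n + 2))) (a i : M)
    (u : Fin n → M) :
    (fn f (Fin.cons s fun j : Fin n => Term.var j.succ.succ)).realize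
      (Fin.cons a (Fin.cons i u) : Fin (n + 2) → M) =
      app f (Fin.cons (s.realize (Fin.cons a (Fin.cons i u) : Fin (n + 2) → M)) u) := by
  rw [realize_fn]
  congr 1
  funext j
  refine Fin.cases ?_ (fun j => ?_) j <;> simp

theorem realize_of_isBaseAxiom [h : M ⊨ baseTheory] {n : ℕ} {φ : LTC.Formula (Fin n)}
    (hφ : IsBaseAxiom φ) (v : Fin n → M) : φ.Realize v :=
  realize_univClosure.1 (h.realize_of_mem _ ⟨n, φ, hφ, rfl⟩) v

/-- The initial axioms, read in a model. -/
theorem initial_axioms [M ⊨ baseTheory] (x y z u : M) :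
    (y ≤ x → y ≤ msucc x) ∧ x ≠ msucc x ∧ 0 ≤ x ∧
    (x ≤ y ∧ x ≠ y ↔ msucc x ≤ y) ∧
    (x ≠ 0 → msucc (msucc 0) * x ≠ 0) ∧
    (y ≤ x ∨ x ≤ y) ∧ (x ≤ y ∧ y ≤ x → x = y) ∧ (x ≤ y ∧ y ≤ z → x ≤ z) ∧
    mlen (0 : M) = 0 ∧
    (x ≠ 0 → mlen (msucc (msucc 0) * x) = msucc (mlen x) ∧
      mlen (msucc (msucc (msucc 0) * x)) = msucc (mlen x)) ∧
    mlen (msucc (0 : M)) = msucc 0 ∧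
    (x ≤ y → mlen x ≤ mlen y) ∧
    mlen (msmash x y) = msucc (mlen x * mlen y) ∧
    msmash 0 y = msucc 0 ∧
    (x ≠ 0 → msmash (msucc 0) (msucc (msucc 0) * x) = msucc (msucc 0) * msmash (msucc 0) x ∧
      msmash (msucc 0) (msucc (msucc (msucc 0) * x)) = msucc (msucc 0) * msmash (msucc 0) x) ∧
    msmash x y = msmash y x ∧
    (mlen x = mlen y → msmash x z = msmash y z) ∧
    (mlen x = mlen u + mlen z → msmash x y = msmash u y * msmash z y) ∧
    x ≤ x + y ∧
    (x ≤ y ∧ x ≠ y → msucc (msucc (msucc 0) * x) ≤ msucc (msucc 0) * y ∧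
      msucc (msucc (msucc 0) * x) ≠ msucc (msucc 0) * y) ∧
    x + y = y + x ∧ x + 0 = x ∧ x + msucc y = msucc (x + y) ∧ x + y + z = x + (y + z) ∧
    (x + y ≤ x + z ↔ y ≤ z) ∧
    x * 0 = 0 ∧ x * msucc y = x * y + x ∧ x * y = y * x ∧ x * (y + z) = x * y + x * z ∧
    (msucc 0 ≤ x → (x * y ≤ x * z ↔ y ≤ z)) ∧
    (x ≠ 0 → mlen x = msucc (mlen (mhalf x))) ∧
    (x = mhalf y ↔ msucc (msucc 0) * x = y ∨ msucc (msucc (msucc 0) * x) = y) ∧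
    (y ≤ x → mmonus x y + y = x) ∧ (x ≤ y → mmonus x y = 0) ∧
    mmsp x 0 = x ∧ mmsp x (msucc y) = mhalf (mmsp x y) ∧ (mlen x ≤ y → mmsp x y = 0) := by
  have h : ∀ φ ∈ initialAxioms, φ.Realize ![x, y, z, u] := fun φ hφ =>
    realize_of_isBaseAxiom (.initial hφ) _
  simpa only [initialAxioms, initialAxiomsOf, List.forall_mem_cons, Formula.realize_imp,
    Formula.realize_iff, Formula.realize_not, Formula.realize_inf, Formula.realize_sup,
    realize_eqF, realize_leF, realize_zero, realize_add, realize_mul, realize_S, realize_half,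
    realize_len, realize_smash, realize_msp, realize_monus, realize_two, Term.realize_var,
    Matrix.cons_val, List.not_mem_nil, false_imp_iff, implies_true, and_true, ne_eq] using h

variable [M ⊨ baseTheory]

namespace Ax

theorem zero_le (x : M) : 0 ≤ x :=
  (initial_axioms x 0 0 0).2.2.1

theorem lt_iff (x y : M) : x ≤ y ∧ x ≠ y ↔ msucc x ≤ y :=
  (initial_axioms x y 0 0).2.2.2.1

theorem le_total (x y : M) : y ≤ x ∨ x ≤ y :=
  (initial_axioms x y 0 0).2.2.2.2.2.1

theorem le_antisymm (x y : M) : x ≤ y ∧ y ≤ x → x = y :=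
  (initial_axioms x y 0 0).2.2.2.2.2.2.1

theorem le_trans (x y z : M) : x ≤ y ∧ y ≤ z → x ≤ z :=
  (initial_axioms x y z 0).2.2.2.2.2.2.2.1

theorem len_zero : mlen (0 : M) = 0 :=
  (initial_axioms 0 0 0 0).2.2.2.2.2.2.2.2.1

theorem len_two_mul (x : M) : x ≠ 0 → mlen (msucc (msucc 0) * x) = msucc (mlen x) ∧
    mlen (msucc (msucc (msucc 0) * x)) = msucc (mlen x) :=
  (initial_axioms x 0 0 0).2.2.2.2.2.2.2.2.2.1

theorem len_one : mlen (msucc (0 : M)) = msucc 0 :=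
  (initial_axioms 0 0 0 0).2.2.2.2.2.2.2.2.2.2.1

theorem len_mono (x y : M) : x ≤ y → mlen x ≤ mlen y :=
  (initial_axioms x y 0 0).2.2.2.2.2.2.2.2.2.2.2.1

theorem len_smash (x y : M) : mlen (msmash x y) = msucc (mlen x * mlen y) :=
  (initial_axioms x y 0 0).2.2.2.2.2.2.2.2.2.2.2.2.1

theorem zero_smash (y : M) : msmash 0 y = msucc 0 :=
  (initial_axioms 0 y 0 0).2.2.2.2.2.2.2.2.2.2.2.2.2.1

theorem one_smash (x : M) : x ≠ 0 →
    msmash (msucc 0) (msucc (msucc 0) * x) = msucc (msucc 0) * msmash (msucc 0) x ∧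
    msmash (msucc 0) (msucc (msucc (msucc 0) * x)) = msucc (msucc 0) * msmash (msucc 0) x :=
  (initial_axioms x 0 0 0).2.2.2.2.2.2.2.2.2.2.2.2.2.2.1

theorem smash_comm (x y : M) : msmash x y = msmash y x :=
  (initial_axioms x y 0 0).2.2.2.2.2.2.2.2.2.2.2.2.2.2.2.1

theorem smash_congr (x y z : M) : mlen x = mlen y → msmash x z = msmash y z :=
  (initial_axioms x y z 0).2.2.2.2.2.2.2.2.2.2.2.2.2.2.2.2.1

theorem smash_add (x y z u : M) : mlen x = mlen u + mlen z → msmash x y = msmash u y * msmash z y :=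
  (initial_axioms x y z u).2.2.2.2.2.2.2.2.2.2.2.2.2.2.2.2.2.1

theorem add_comm (x y : M) : x + y = y + x :=
  (initial_axioms x y 0 0).2.2.2.2.2.2.2.2.2.2.2.2.2.2.2.2.2.2.2.2.1

theorem add_zero (x : M) : x + 0 = x :=
  (initial_axioms x 0 0 0).2.2.2.2.2.2.2.2.2.2.2.2.2.2.2.2.2.2.2.2.2.1

theorem add_succ (x y : M) : x + msucc y = msucc (x + y) :=
  (initial_axioms x y 0 0).2.2.2.2.2.2.2.2.2.2.2.2.2.2.2.2.2.2.2.2.2.2.1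

theorem add_assoc (x y z : M) : x + y + z = x + (y + z) :=
  (initial_axioms x y z 0).2.2.2.2.2.2.2.2.2.2.2.2.2.2.2.2.2.2.2.2.2.2.2.1

theorem add_le_add (x y z : M) : x + y ≤ x + z ↔ y ≤ z :=
  (initial_axioms x y z 0).2.2.2.2.2.2.2.2.2.2.2.2.2.2.2.2.2.2.2.2.2.2.2.2.1

theorem mul_zero (x : M) : x * 0 = 0 :=
  (initial_axioms x 0 0 0).2.2.2.2.2.2.2.2.2.2.2.2.2.2.2.2.2.2.2.2.2.2.2.2.2.1

theorem mul_succ (x y : M) : x * msucc y = x * y + x :=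
  (initial_axioms x y 0 0).2.2.2.2.2.2.2.2.2.2.2.2.2.2.2.2.2.2.2.2.2.2.2.2.2.2.1

theorem mul_comm (x y : M) : x * y = y * x :=
  (initial_axioms x y 0 0).2.2.2.2.2.2.2.2.2.2.2.2.2.2.2.2.2.2.2.2.2.2.2.2.2.2.2.1

theorem mul_add (x y z : M) : x * (y + z) = x * y + x * z :=
  (initial_axioms x y z 0).2.2.2.2.2.2.2.2.2.2.2.2.2.2.2.2.2.2.2.2.2.2.2.2.2.2.2.2.1

theorem mul_le_mul (x y z : M) : msucc 0 ≤ x → (x * y ≤ x * z ↔ y ≤ z) :=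
  (initial_axioms x y z 0).2.2.2.2.2.2.2.2.2.2.2.2.2.2.2.2.2.2.2.2.2.2.2.2.2.2.2.2.2.1

theorem len_half (x : M) : x ≠ 0 → mlen x = msucc (mlen (mhalf x)) :=
  (initial_axioms x 0 0 0).2.2.2.2.2.2.2.2.2.2.2.2.2.2.2.2.2.2.2.2.2.2.2.2.2.2.2.2.2.2.1

theorem half_iff (x y : M) : x = mhalf y ↔
    msucc (msucc 0) * x = y ∨ msucc (msucc (msucc 0) * x) = y :=
  (initial_axioms x y 0 0).2.2.2.2.2.2.2.2.2.2.2.2.2.2.2.2.2.2.2.2.2.2.2.2.2.2.2.2.2.2.2.1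

theorem monus_add (x y : M) : y ≤ x → mmonus x y + y = x :=
  (initial_axioms x y 0 0).2.2.2.2.2.2.2.2.2.2.2.2.2.2.2.2.2.2.2.2.2.2.2.2.2.2.2.2.2.2.2.2.1

theorem monus_zero (x y : M) : x ≤ y → mmonus x y = 0 :=
  (initial_axioms x y 0 0).2.2.2.2.2.2.2.2.2.2.2.2.2.2.2.2.2.2.2.2.2.2.2.2.2.2.2.2.2.2.2.2.2.1

theorem msp_zero (x : M) : mmsp x 0 = x :=
  (initial_axioms x 0 0 0).2.2.2.2.2.2.2.2.2.2.2.2.2.2.2.2.2.2.2.2.2.2.2.2.2.2.2.2.2.2.2.2.2.2.1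

theorem msp_succ (x y : M) : mmsp x (msucc y) = mhalf (mmsp x y) :=
  (initial_axioms x y 0 0).2.2.2.2.2.2.2.2.2.2.2.2.2.2.2.2.2.2.2.2.2.2.2.2.2.2.2.2.2.2.2.2.2.2.2.1

theorem msp_of_len_le (x y : M) : mlen x ≤ y → mmsp x y = 0 :=
  (initial_axioms x y 0 0).2.2.2.2.2.2.2.2.2.2.2.2.2.2.2.2.2.2.2.2.2.2.2.2.2.2.2.2.2.2.2.2.2.2.2.2

end Ax

end Operations

/-! ### Models of the base theory as discretely ordered semirings -/

section Additive

attribute [local instance] zeroOf oneOf addOf mulOf leOf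

variable {M : Type} [LTC.Structure M] [M ⊨ baseTheory]

theorem msucc_eq (x : M) : msucc x = x + 1 :=
  ((Ax.add_succ x 0).trans (congrArg msucc (Ax.add_zero x))).symm

variable (M) in
abbrev addMonoidOf : AddCommMonoid M where
  __ := (inferInstance : Zero M)
  __ := (inferInstance : Add M)
  nsmul := nsmulRec
  add_assoc := Ax.add_assoc
  add_comm := Ax.add_comm
  zero_add x := (Ax.add_comm 0 x).trans (Ax.add_zero x)
  add_zero := Ax.add_zero

variable (M) in
noncomputable abbrev linearOrderOf : LinearOrder M where
  __ := (inferInstance : LE M)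
  le_refl x := (Ax.le_total x x).elim id id
  le_trans x y z h1 h2 := Ax.le_trans x y z ⟨h1, h2⟩
  le_antisymm x y h1 h2 := Ax.le_antisymm x y ⟨h1, h2⟩
  le_total x y := (Ax.le_total x y).symm
  toDecidableLE := Classical.decRel _

attribute [local instance] addMonoidOf linearOrderOf

variable {x y z : M}

theorem isOrderedCancelAddMonoid : IsOrderedCancelAddMonoid M where
  add_le_add_left x y h z := by
    rw [add_comm x, add_comm y]
    exact (Ax.add_le_add z x y).2 h
  le_of_add_le_add_left x y z h := (Ax.add_le_add x y z).1 h

attribute [local instance] isOrderedCancelAddMonoid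

theorem m_zero_le (x : M) : 0 ≤ x := Ax.zero_le x

theorem m_add_one_le_iff : x + 1 ≤ y ↔ x < y := by
  rw [← msucc_eq, lt_iff_le_and_ne]; exact (Ax.lt_iff x y).symm

theorem m_lt_add_one_iff : x < y + 1 ↔ x ≤ y := by
  rw [← m_add_one_le_iff, add_le_add_iff_right]

theorem m_lt_add_one (x : M) : x < x + 1 := m_lt_add_one_iff.2 le_rfl

theorem m_pos_iff : 0 < x ↔ x ≠ 0 := by
  rw [lt_iff_le_and_ne, ne_comm]; exact and_iff_right (m_zero_le x)

theorem m_monus_add (h : y ≤ x) : mmonus x y + y = x :=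
  Ax.monus_add x y h

theorem m_monus_eq_zero : mmonus x y = 0 ↔ x ≤ y := by
  constructor
  · intro h
    rcases le_total x y with h1 | h1
    · exact h1
    · have := m_monus_add h1
      rw [h, zero_add] at this; exact this.ge
  · exact Ax.monus_zero x y

theorem m_monus_unique (h : z + y = x) : mmonus x y = z := by
  have h1 : y ≤ x := h ▸ le_add_of_nonneg_left (m_zero_le z)
  exact add_right_cancel ((m_monus_add h1).trans h.symm)

theorem m_exists_add (h : y ≤ x) : ∃ z, x = z + y := ⟨_, (m_monus_add h).symm⟩

theorem m_exists_succ (h : x ≠ 0) : ∃ z, x = z + 1 := by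
  refine m_exists_add ?_
  have := m_add_one_le_iff.2 (m_pos_iff.2 h)
  rwa [zero_add] at this

theorem m_add_eq_zero : x + y = 0 ↔ x = 0 ∧ y = 0 := by
  rw [add_eq_zero_iff_of_nonneg (m_zero_le x) (m_zero_le y)]

theorem m_two_mul (x : M) : msucc (msucc 0) * x = x + x := by
  have h1 : msucc (msucc 0) * x = x * msucc (msucc 0) :=
    Ax.mul_comm _ _
  have h2 : x * msucc (msucc 0) = x * msucc 0 + x := Ax.mul_succ _ _
  have h3 : x * msucc 0 = x * 0 + x := Ax.mul_succ _ _
  have h4 : x * 0 = 0 := Ax.mul_zero _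
  rw [h1, h2, h3, h4, zero_add]

theorem m_half_cases (x : M) :
    x = mhalf x + mhalf x ∨ x = mhalf x + mhalf x + 1 := by
  rw [← msucc_eq, ← m_two_mul, eq_comm, @eq_comm _ x]
  exact (Ax.half_iff (mhalf x) x).1 rfl

theorem m_half_eq_iff : x = mhalf y ↔ y = x + x ∨ y = x + x + 1 := by
  rw [← msucc_eq, ← m_two_mul, @eq_comm _ y, @eq_comm _ y]
  exact Ax.half_iff x y

theorem m_half_add_self_one (x : M) : mhalf (x + x + 1) = x := (m_half_eq_iff.2 (.inr rfl)).symm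

theorem m_half_le (x : M) : mhalf x ≤ x := by
  rcases m_half_cases x with h | h
  · exact (le_add_of_nonneg_left (m_zero_le _)).trans h.ge
  · exact ((le_add_of_nonneg_left (m_zero_le _)).trans
      (le_add_of_nonneg_right (m_zero_le _))).trans h.ge

theorem m_len_zero : mlen (0 : M) = 0 := Ax.len_zero

theorem m_len_one : mlen (1 : M) = 1 := Ax.len_one

theorem m_len_mono (h : x ≤ y) : mlen x ≤ mlen y := Ax.len_mono x y h

theorem m_len_half (h : x ≠ 0) : mlen x = mlen (mhalf x) + 1 := by
  rw [← msucc_eq]; exact Ax.len_half x h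

theorem m_len_eq_zero : mlen x = 0 ↔ x = 0 := by
  refine ⟨fun h => by_contra fun h1 => ?_, fun h => by rw [h, m_len_zero]⟩
  rw [m_len_half h1, m_add_eq_zero] at h
  have := m_lt_add_one (0 : M)
  rw [h.2, add_zero] at this
  exact this.false

theorem m_msp_zero (x : M) : mmsp x 0 = x := Ax.msp_zero x

theorem m_msp_succ (x y : M) : mmsp x (y + 1) = mhalf (mmsp x y) := by
  rw [← msucc_eq]; exact Ax.msp_succ x y

theorem m_msp_of_len_le (h : mlen x ≤ y) : mmsp x y = 0 := Ax.msp_of_len_le x y h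

theorem realize_ltF {α : Type} {v : α → M} {s t : LTC.Term α} :
    (ltF s t).Realize v ↔ s.realize v < t.realize v := by
  rw [realize_ltF_raw, lt_iff_le_and_ne]

/-! ### Induction for open formulas -/

/-- A function symbol computing the value of a term. -/
def termFunc {n : ℕ} : LTC.Term (Fin n) → TCFunc n
  | .var i => .proj i
  | .func (l := l) f ts => .comp (n := l) f fun i => termFunc (ts i)

theorem app_termFunc {n : ℕ} (t : LTC.Term (Fin n)) (v : Fin n → M) :
    app (termFunc t) v = t.realize v := by
  induction t with
  | var i =>
    have := realize_of_isBaseAxiom (.proj i) v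
    rw [realize_eqF] at this
    exact this
  | func f ts ih =>
    have := realize_of_isBaseAxiom (.comp f fun i => termFunc (ts i)) v
    rw [realize_eqF] at this
    refine Eq.trans this ?_
    exact congrArg (app f) (funext ih)

theorem m_least_le {n : ℕ} (f : TCFunc (n + 1)) (a : M) (u : Fin n → M) :
    app (.least f) (Fin.cons a u) ≤ mlen a := by
  have := realize_of_isBaseAxiom (.least_le f) (Fin.cons a (Fin.cons 0 u) : Fin (n + 2) → M)
  simpa only [realize_leF, realize_len, realize_cons_param, Term.realize_var, Fin.cons_zero]
    using this

theorem m_least_spec {n : ℕ} (f : TCFunc (n + 1)) (a : M) (u : Fin n → M)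
    (h : app (.least f) (Fin.cons a u) < mlen a) :
    app f (Fin.cons (app (.least f) (Fin.cons a u)) u) ≠ 0 := by
  have := realize_of_isBaseAxiom (.least_spec f) (Fin.cons a (Fin.cons 0 u) : Fin (n + 2) → M)
  simp only [Formula.realize_imp, Formula.realize_not, realize_eqF, realize_ltF, realize_len,
    realize_cons_param, Term.realize_var, Fin.cons_zero, realize_zero] at this
  exact this h

theorem m_least_min {n : ℕ} (f : TCFunc (n + 1)) (a i : M) (u : Fin n → M)
    (h : i < app (.least f) (Fin.cons a u)) : app f (Fin.cons i u) = 0 := by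
  have := realize_of_isBaseAxiom (.least_min f) (Fin.cons a (Fin.cons i u) : Fin (n + 2) → M)
  have h1 : (Fin.cons a (Fin.cons i u) : Fin (n + 2) → M) 1 = i := rfl
  simp only [Formula.realize_imp, realize_eqF, realize_ltF,
    realize_cons_param, Term.realize_var, Fin.cons_zero, realize_zero, h1] at this
  exact this h

/-- Induction up to a length for a predicate defined by an equation between terms. -/
theorem open_lind {n : ℕ} (t : LTC.Term (Fin (n + 1))) (u : Fin n → M) (a : M)
    (h0 : t.realize (Fin.cons 0 u : Fin (n + 1) → M) = 0)
    (hs : ∀ i, i + 1 ≤ mlen a → t.realize (Fin.cons i u : Fin (n + 1) → M) = 0 →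
      t.realize (Fin.cons (i + 1) u : Fin (n + 1) → M) = 0) (i : M) (hi : i ≤ mlen a) :
    t.realize (Fin.cons i u : Fin (n + 1) → M) = 0 := by
  have hle := m_least_le (termFunc t) a u
  have hsp := m_least_spec (termFunc t) a u
  have hmin := m_least_min (termFunc t) a (u := u)
  generalize app (.least (termFunc t)) (Fin.cons a u) = m at hle hsp hmin
  simp only [app_termFunc] at hsp hmin
  -- A value below `|a|` would be a least counterexample: it is not `0` by `h0` and not a successor
  -- by `hs`.
  have hm : m = mlen a := by
    by_contra hne
    have hlt := lt_of_le_of_ne hle hne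
    by_cases hm0 : m = 0
    · exact hsp hlt (hm0 ▸ h0)
    · obtain ⟨m', rfl⟩ := m_exists_succ hm0
      exact hsp hlt (hs m' hle (hmin m' (m_lt_add_one m')))
  subst hm
  -- `least` only searches below `|a|`, so the endpoint `i = |a|` needs one further use of `hs`.
  by_cases hi0 : i = 0
  · exact hi0 ▸ h0
  · obtain ⟨i', rfl⟩ := m_exists_succ hi0
    exact hs i' hi (hmin i' (m_add_one_le_iff.1 hi))

/-- Polynomial induction for a predicate defined by an equation between terms. -/
theorem open_pind {n : ℕ} (t : LTC.Term (Fin (n + 1))) (u : Fin n → M)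
    (h0 : t.realize (Fin.cons 0 u : Fin (n + 1) → M) = 0)
    (hs : ∀ y, y ≠ 0 → t.realize (Fin.cons (mhalf y) u : Fin (n + 1) → M) = 0 →
      t.realize (Fin.cons y u : Fin (n + 1) → M) = 0) (y : M) :
    t.realize (Fin.cons y u : Fin (n + 1) → M) = 0 := by
  -- `s` evaluates `t` at `⌊y / 2 ^ (|y| - i)⌋`, the number formed by the `i` leading bits of `y`.
  -- Increasing `i` by one undoes one halving, so length induction on `i` leads from `0` to `y`.
  let s : LTC.Term (Fin (n + 2)) := t.subst
    (Fin.cons (msp (.var 1) (monus (len (.var 1)) (.var 0))) fun j => .var j.succ.succ)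
  have key (i : M) : s.realize (Fin.cons i (Fin.cons y u) : Fin (n + 2) → M) =
      t.realize (Fin.cons (mmsp y (mmonus (mlen y) i)) u : Fin (n + 1) → M) := by
    rw [Term.realize_subst]
    congr 1
    funext j
    refine Fin.cases ?_ (fun j => ?_) j
    · simp only [Fin.cons_zero, realize_msp, realize_monus, realize_len, Term.realize_var]; rfl
    · simp
  have := open_lind s (Fin.cons y u) y ?_ ?_ (mlen y) le_rfl
  · rwa [key, m_monus_eq_zero.2 le_rfl, m_msp_zero] at this
  · rw [key, m_monus_unique (add_zero _), m_msp_of_len_le le_rfl]; exact h0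
  · intro i hi ih
    obtain ⟨m, hm⟩ := m_exists_add hi
    rw [key] at ih ⊢
    rw [m_monus_unique hm.symm]
    rw [m_monus_unique (show m + 1 + i = mlen y by rw [hm]; abel), m_msp_succ] at ih
    -- The induction step is only assumed at nonzero numbers; a zero prefix is the base case again.
    by_cases hz : mmsp y m = 0
    · rw [hz]; exact h0
    · exact hs _ hz ih

end Additive

-- Multiplication, powers of two, pairing and term bounds in the base theory.

section Arithmetic

attribute [local instance] zeroOf oneOf addOf mulOf leOf addMonoidOf linearOrderOf
  isOrderedCancelAddMonoid

variable {M : Type} [LTC.Structure M] [M ⊨ baseTheory]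

/-- Truncated subtraction vanishes exactly when the inequality holds, which turns it into an
equation between terms. The version for equalities adds the two differences. -/
theorem open_pind_le {n : ℕ} (s t : LTC.Term (Fin (n + 1))) (u : Fin n → M)
    (h0 : s.realize (Fin.cons 0 u : Fin (n + 1) → M) ≤ t.realize (Fin.cons 0 u : Fin (n + 1) → M))
    (hs : ∀ y, y ≠ 0 → s.realize (Fin.cons (mhalf y) u : Fin (n + 1) → M) ≤
        t.realize (Fin.cons (mhalf y) u : Fin (n + 1) → M) →
      s.realize (Fin.cons y u : Fin (n + 1) → M) ≤ t.realize (Fin.cons y u : Fin (n + 1) → M))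
    (y : M) :
    s.realize (Fin.cons y u : Fin (n + 1) → M) ≤ t.realize (Fin.cons y u : Fin (n + 1) → M) := by
  have := open_pind (monus s t) u
  simp only [realize_monus, m_monus_eq_zero] at this
  exact this h0 hs y

theorem open_pind_eq {n : ℕ} (s t : LTC.Term (Fin (n + 1))) (u : Fin n → M)
    (h0 : s.realize (Fin.cons 0 u : Fin (n + 1) → M) = t.realize (Fin.cons 0 u : Fin (n + 1) → M))
    (hs : ∀ y, y ≠ 0 → s.realize (Fin.cons (mhalf y) u : Fin (n + 1) → M) =
        t.realize (Fin.cons (mhalf y) u : Fin (n + 1) → M) →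
      s.realize (Fin.cons y u : Fin (n + 1) → M) = t.realize (Fin.cons y u : Fin (n + 1) → M))
    (y : M) :
    s.realize (Fin.cons y u : Fin (n + 1) → M) = t.realize (Fin.cons y u : Fin (n + 1) → M) := by
  have := open_pind (monus s t + monus t s) u
  simp only [realize_add, realize_monus, m_add_eq_zero, m_monus_eq_zero, ← le_antisymm_iff] at this
  exact this h0 hs y

theorem m_mul_one (x : M) : x * 1 = x := by
  refine (Ax.mul_succ x 0).trans ?_
  rw [Ax.mul_zero, zero_add]

/-- Associativity is not among the axioms. Polynomial induction on the last factor reduces it to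
distributivity over `c + c` and `c + c + 1`. -/
theorem m_mul_assoc (x y z : M) : x * y * z = x * (y * z) := by
  have := open_pind_eq (.var 1 * .var 2 * .var 0 : LTC.Term (Fin 3)) (.var 1 * (.var 2 * .var 0))
    ![x, y]
  simp only [realize_mul, Term.realize_var] at this
  refine this ?_ ?_ z
  · change x * y * 0 = x * (y * 0)
    simp only [Ax.mul_zero]
  · intro z _ (ih : x * y * mhalf z = x * (y * mhalf z))
    change x * y * z = x * (y * z)
    rcases m_half_cases z with h | h <;> generalize mhalf z = c at ih h <;> subst h <;>
      simp only [Ax.mul_add, m_mul_one, ih]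

variable (M) in
abbrev semiringOf : CommSemiring M where
  __ := addMonoidOf M
  __ := (inferInstance : One M)
  __ := (inferInstance : Mul M)
  mul_comm := Ax.mul_comm
  mul_assoc := m_mul_assoc
  mul_zero := Ax.mul_zero
  zero_mul x := (Ax.mul_comm 0 x).trans (Ax.mul_zero x)
  mul_one := m_mul_one
  one_mul x := (Ax.mul_comm 1 x).trans (m_mul_one x)
  left_distrib := Ax.mul_add
  right_distrib x y z := by
    rw [Ax.mul_comm, Ax.mul_add, Ax.mul_comm z, Ax.mul_comm z]

attribute [local instance] semiringOf

variable {x y z w u v : M}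

theorem m_mul_le_mul_iff (h : 0 < x) : x * y ≤ x * z ↔ y ≤ z := by
  refine Ax.mul_le_mul x y z ?_
  rw [← m_add_one_le_iff, zero_add] at h
  exact h

theorem isStrictOrderedRing : IsStrictOrderedRing M where
  zero_le_one := m_zero_le 1
  exists_pair_ne := ⟨0, 1, by have := m_lt_add_one (0 : M); rw [zero_add] at this; exact this.ne⟩
  mul_lt_mul_of_pos_left x hx y z h := by
    rwa [← not_le, m_mul_le_mul_iff hx, not_le]
  mul_lt_mul_of_pos_right x hx y z h := by
    rw [mul_comm y, mul_comm z]; rwa [← not_le, m_mul_le_mul_iff hx, not_le]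

attribute [local instance] isStrictOrderedRing

theorem canonicallyOrderedAdd : CanonicallyOrderedAdd M where
  le_add_self x y := le_add_of_nonneg_left (m_zero_le y)
  le_self_add x y := le_add_of_nonneg_right (m_zero_le y)
  exists_add_of_le {x y} h := by obtain ⟨z, hz⟩ := m_exists_add h; exact ⟨z, by rw [hz, add_comm]⟩

attribute [local instance] canonicallyOrderedAdd

/-! ### Powers of two -/

theorem m_len_pow (x : M) : mlen (mpow x) = mlen x + 1 := by
  rw [mpow, Ax.len_smash, m_len_one, one_mul, msucc_eq]

theorem m_pow_pos (x : M) : 0 < mpow x := by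
  rw [m_pos_iff]
  intro h
  have := m_len_pow x
  rw [h, m_len_zero, eq_comm, m_add_eq_zero] at this
  exact one_ne_zero this.2

theorem m_pow_congr (h : mlen x = mlen y) : mpow x = mpow y := by
  rw [mpow, mpow, Ax.smash_comm, Ax.smash_congr x y 1 h, Ax.smash_comm]

theorem m_pow_mul_pow (h : mlen x = mlen y + mlen z) : mpow x = mpow y * mpow z := by
  rw [mpow, Ax.smash_comm, Ax.smash_add x 1 z y h, Ax.smash_comm y, Ax.smash_comm z]; rfl

theorem m_pow_zero : mpow (0 : M) = 1 := (Ax.smash_comm 1 0).trans (Ax.zero_smash 1)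

theorem m_len_add_self (h : x ≠ 0) : mlen (x + x) = mlen x + 1 := by
  rw [← m_two_mul, (Ax.len_two_mul x h).1, msucc_eq]

theorem m_pow_add_self (h : x ≠ 0) : mpow (x + x) = mpow x + mpow x := by
  rw [← m_two_mul, ← m_two_mul]; exact (Ax.one_smash x h).1

/-- The doubling axiom for `1 # x` and the addition law for lengths evaluate `1 # 2` as twice `1 #
1` and as its square; cancel. -/
theorem m_pow_one : mpow (1 : M) = 1 + 1 := by
  have h1 : mpow (1 + 1 : M) = mpow 1 * mpow 1 :=
    m_pow_mul_pow (by rw [m_len_add_self one_ne_zero, m_len_one])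
  rw [m_pow_add_self one_ne_zero, ← mul_one (mpow (1 : M)), mul_assoc, ← mul_add] at h1
  simpa using (mul_left_cancel₀ (m_pow_pos 1).ne' h1).symm

theorem m_pow_half (h : x ≠ 0) : mpow x = mpow (mhalf x) + mpow (mhalf x) := by
  by_cases h0 : mhalf x = 0
  · have hx : x = 1 := by
      rcases m_half_cases x with h1 | h1
      · rw [h0, add_zero] at h1; exact absurd h1 h
      · rwa [h0, add_zero, zero_add] at h1
    rw [h0, m_pow_zero, hx, m_pow_one]
  · rw [← m_pow_add_self h0]
    exact m_pow_congr (by rw [m_len_half h, m_len_add_self h0])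

theorem m_add_self_le (h : x ≤ y) : x + x ≤ y + y := add_le_add h h

theorem m_lt_pow (x : M) : x < mpow x := by
  rw [← m_add_one_le_iff, ← msucc_eq]
  have := open_pind_le (S (.var 0) : LTC.Term (Fin 1)) (powT (.var 0)) (![] : Fin 0 → M)
  simp only [realize_S, realize_powT, Term.realize_var, Fin.cons_zero] at this
  refine this ?_ ?_ x
  · rw [m_pow_zero, msucc_eq, zero_add]
  · intro y hy ih
    rw [msucc_eq] at ih ⊢
    rw [m_pow_half hy]
    refine le_trans ?_ (m_add_self_le ih)
    rcases m_half_cases y with h | h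
    · conv_lhs => rw [h]
      have : mhalf y + 1 + (mhalf y + 1) = mhalf y + mhalf y + 1 + 1 := by ring
      rw [this]
      exact (m_lt_add_one _).le
    · conv_lhs => rw [h]
      exact (by ring : mhalf y + mhalf y + 1 + 1 = _).le

/-- In binary, `2 ^ |x| - 1` is a string of `|x|` ones: if `2 ^ |⌊x / 2⌋| = c + 1`, then it equals
`c + c + 1`, whose half is `c`. -/
theorem m_len_pow_pred (x : M) : mlen (mmonus (mpow x) 1) = mlen x := by
  have := open_pind_eq (len (monus (powT (.var 0)) (S 0)) : LTC.Term (Fin 1))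
    (len (.var 0)) (![] : Fin 0 → M)
  simp only [realize_S, realize_powT, realize_len, realize_monus, Term.realize_var,
    Fin.cons_zero, realize_zero, msucc_eq, zero_add] at this
  refine this ?_ ?_ x
  · rw [m_pow_zero, m_monus_unique (zero_add 1)]
  · intro y hy ih
    obtain ⟨c, hc⟩ := m_exists_succ (m_pow_pos (mhalf y)).ne'
    rw [hc, m_monus_unique rfl] at ih
    rw [m_pow_half hy, hc, m_monus_unique (show c + c + 1 + 1 = c + 1 + (c + 1) by ring),
      m_len_half hy, ← ih, m_len_half, m_half_add_self_one]
    exact (m_pos_iff.1 ((m_zero_le _).trans_lt (m_lt_add_one _)))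

/-- Monotonicity of length, with `2 ^ |u|` below and, for `u ≠ 0`, `2 ^ |u + u| - 1` above; both
have length `|u| + 1`. Doubling does not lengthen `0`, hence the case distinction. -/
theorem m_len_eq_of_pow (h1 : mpow u ≤ w) (h2 : w < mpow u + mpow u) : mlen w = mlen u + 1 := by
  apply le_antisymm
  · by_cases hu : u = 0
    · subst hu
      rw [m_pow_zero, m_lt_add_one_iff] at h2
      have := m_len_mono h2
      rwa [m_len_one, ← zero_add (1 : M), ← m_len_zero] at this
    · rw [← m_pow_add_self hu] at h2
      have h3 : w ≤ mmonus (mpow (u + u)) 1 := by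
        obtain ⟨c, hc⟩ := m_exists_succ (m_pow_pos (u + u)).ne'
        rw [hc, m_lt_add_one_iff] at h2
        rwa [hc, m_monus_unique rfl]
      have := m_len_mono h3
      rwa [m_len_pow_pred, m_len_add_self hu] at this
  · have := m_len_mono h1
    rwa [m_len_pow] at this

/-- Otherwise `u ≥ 2 (v + 1)`, whose length exceeds `|v|`. This is how bounds on lengths become
bounds on values. -/
theorem m_le_of_len_le (h : mlen u ≤ mlen v) : u ≤ v + v + 1 := by
  by_contra hlt
  rw [not_le, ← m_add_one_le_iff] at hlt
  have h1 := m_len_mono hlt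
  rw [show v + v + 1 + 1 = v + 1 + (v + 1) by ring, m_len_add_self (by simp)] at h1
  have h2 : mlen v + 1 ≤ mlen v :=
    ((add_le_add_left (m_len_mono (m_lt_add_one v).le) 1).trans h1).trans h
  exact absurd h2 (not_le.2 (m_lt_add_one _))

/-! ### Division by powers of two -/

/-- With `m_lt_msp_mul` this says that `msp` by `|y|` is the Euclidean quotient by `2 ^ |y|`. The
exponent is given as a length so that polynomial induction on `y` raises it by one at each step. -/
theorem m_msp_mul_le (w y : M) : mmsp w (mlen y) * mpow y ≤ w := by
  have := open_pind_le (msp (.var 1) (len (.var 0)) * powT (.var 0) : LTC.Term (Fin 2))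
    (.var 1) ![w]
  simp only [realize_mul, realize_msp, realize_len, realize_powT, Term.realize_var] at this
  refine this ?_ ?_ y
  · change mmsp w (mlen 0) * mpow 0 ≤ w
    rw [m_len_zero, m_msp_zero, m_pow_zero, mul_one]
  · intro z hz (ih : mmsp w (mlen (mhalf z)) * mpow (mhalf z) ≤ w)
    change mmsp w (mlen z) * mpow z ≤ w
    rw [m_len_half hz, m_msp_succ, m_pow_half hz]
    refine le_trans ?_ ih
    rw [mul_add, ← add_mul]
    refine mul_le_mul_left ?_ _
    rcases m_half_cases (mmsp w (mlen (mhalf z))) with h | h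
    · exact h.ge
    · exact (m_lt_add_one _).le.trans h.ge

theorem m_lt_msp_mul (w y : M) : w < (mmsp w (mlen y) + 1) * mpow y := by
  have := open_pind_le (S (.var 1))
    (S (msp (.var 1) (len (.var 0))) * powT (.var 0) : LTC.Term (Fin 2)) ![w]
  simp only [realize_mul, realize_msp, realize_len, realize_powT, realize_S, Term.realize_var,
    msucc_eq] at this
  rw [← m_add_one_le_iff]
  refine this ?_ ?_ y
  · change w + 1 ≤ (mmsp w (mlen 0) + 1) * mpow 0
    rw [m_len_zero, m_msp_zero, m_pow_zero, mul_one]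
  · intro z hz (ih : w + 1 ≤ (mmsp w (mlen (mhalf z)) + 1) * mpow (mhalf z))
    change w + 1 ≤ (mmsp w (mlen z) + 1) * mpow z
    rw [m_len_half hz, m_msp_succ, m_pow_half hz]
    refine ih.trans ?_
    rw [mul_add, ← add_mul]
    refine mul_le_mul_left ?_ _
    generalize mmsp w (mlen (mhalf z)) = q
    rcases m_half_cases q with h | h
    · conv_lhs => rw [h]
      rw [show mhalf q + 1 + (mhalf q + 1) = mhalf q + mhalf q + 1 + 1 by ring]
      exact (m_lt_add_one _).le
    · conv_lhs => rw [h]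
      exact (by ring : mhalf q + mhalf q + 1 + 1 = _).le

theorem m_msp_eq (h : z < mpow y) : mmsp (u * mpow y + z) (mlen y) = u := by
  have h1 := m_msp_mul_le (u * mpow y + z) y
  have h2 := m_lt_msp_mul (u * mpow y + z) y
  generalize mmsp (u * mpow y + z) (mlen y) = q at h1 h2
  have hp := m_pow_pos y
  apply le_antisymm
  · rw [← m_lt_add_one_iff]
    refine lt_of_mul_lt_mul_right (h1.trans_lt ?_) hp.le
    rw [add_mul, one_mul]
    exact (add_lt_add_iff_left _).2 h
  · rw [← m_lt_add_one_iff]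
    exact lt_of_mul_lt_mul_right (le_self_add.trans_lt h2) hp.le

theorem m_msp_le (x i : M) : mmsp x i ≤ x := by
  by_cases hi : i ≤ mlen x
  · have := open_lind (monus (msp (.var 1) (.var 0)) (.var 1) : LTC.Term (Fin 2)) ![x] x
    simp only [realize_msp, realize_monus, Term.realize_var, m_monus_eq_zero] at this
    refine this ?_ ?_ i hi
    · change mmsp x 0 ≤ x
      rw [m_msp_zero]
    · intro i _ (ih : mmsp x i ≤ x)
      change mmsp x (i + 1) ≤ x
      rw [m_msp_succ]
      exact (m_half_le _).trans ih
  · rw [m_msp_of_len_le (not_le.1 hi).le]; exact m_zero_le x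

theorem m_monus_le (x y : M) : mmonus x y ≤ x := by
  rcases le_total x y with h | h
  · rw [m_monus_eq_zero.2 h]; exact m_zero_le x
  · conv_rhs => rw [← m_monus_add h]
    exact le_self_add

/-! ### A surjective pairing -/

theorem m_three_ne_zero : (1 + 1 + 1 : M) ≠ 0 := by simp

theorem m_len_smash_three (x : M) : mlen (msmash x (1 + 1 + 1)) = mlen x + mlen x + 1 := by
  have h2 : mhalf (1 + 1 + 1 : M) = 1 := m_half_add_self_one 1
  rw [Ax.len_smash, m_len_half m_three_ne_zero, h2, m_len_one, msucc_eq, mul_add, mul_one]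

/-- With `K = 2 ^ |y + z|`, both components are below `K` and the code is `(K + y) * K + z`. The
leading `K` fixes its length at `2 |y + z| + 1`, so half the length of the code tells the decoder
where to cut. -/
theorem m_exists_pair (y z : M) : ∃ w, mfst w = y ∧ msnd w = z ∧
    mlen w = mlen (y + z) + mlen (y + z) + 1 := by
  generalize hx : y + z = x
  have hyK : y < mpow x := (hx ▸ le_self_add).trans_lt (m_lt_pow x)
  have hzK : z < mpow x := (hx ▸ le_add_self).trans_lt (m_lt_pow x)
  have hq : mlen (mpow x + y) = mlen x + 1 :=
    m_len_eq_of_pow le_self_add ((add_lt_add_iff_left _).2 hyK)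
  have hq0 : mpow x + y ≠ 0 := fun h => (m_pow_pos x).ne' (m_add_eq_zero.1 h).1
  have hhq : mpow (mhalf (mpow x + y)) = mpow x := by
    refine m_pow_congr (add_right_cancel (b := (1 : M)) ?_)
    rw [← hq, m_len_half hq0]
  -- `K * K` must be exhibited as `2 ^ |t|`: since `|x # 3| = 2 |x| + 1`, halving gives a number of
  -- length `2 |x|`.
  let t : M := mhalf (msmash x (1 + 1 + 1))
  have ht : mlen t = mlen x + mlen x := by
    have h0 : msmash x (1 + 1 + 1) ≠ 0 := by
      rw [Ne, ← m_len_eq_zero, m_len_smash_three]; simp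
    refine add_right_cancel (b := (1 : M)) ?_
    rw [← m_len_half h0, m_len_smash_three]
  have hw : mlen ((mpow x + y) * mpow x + z) = mlen x + mlen x + 1 := by
    rw [← ht]
    apply m_len_eq_of_pow
    · rw [m_pow_mul_pow ht, add_mul, add_assoc]
      exact le_self_add
    · rw [m_pow_mul_pow ht, ← add_mul]
      refine ((add_lt_add_iff_left _).2 hzK).trans_le ?_
      rw [← add_one_mul]
      refine mul_le_mul_left ?_ _
      rw [add_assoc]
      exact (add_le_add_iff_left _).2 (m_add_one_le_iff.2 hyK)
  have hn : mhalf (mlen ((mpow x + y) * mpow x + z)) = mlen x := by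
    rw [hw, m_half_add_self_one]
  refine ⟨(mpow x + y) * mpow x + z, ?_, ?_, hw⟩
  · rw [mfst, hn, m_msp_eq hzK, hhq]
    exact m_monus_unique (add_comm _ _)
  · rw [msnd, hn, m_msp_eq hzK, hhq]
    exact m_monus_unique (add_comm _ _)

/-! ### Monotone bounds for terms -/

theorem m_bits_len {n : ℕ} (f : TCFunc (n + 1)) (a : M) (u : Fin n → M) :
    mlen (app (.bits f) (Fin.cons a u)) ≤ mlen a := by
  have := realize_of_isBaseAxiom (.bits_len f) (Fin.cons a (Fin.cons 0 u) : Fin (n + 2) → M)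
  simpa only [realize_leF, realize_len, realize_cons_param, Term.realize_var, Fin.cons_zero]
    using this

theorem app_proj {n : ℕ} (i : Fin n) (v : Fin n → M) : app (.proj i) v = v i := by
  have := realize_of_isBaseAxiom (.proj i) v
  rw [realize_eqF] at this
  exact this

theorem app_comp {n m : ℕ} (f : TCFunc n) (g : Fin n → TCFunc m) (v : Fin m → M) :
    app (.comp f g) v = app f fun j => app (g j) v := by
  have := realize_of_isBaseAxiom (.comp f g) v
  rw [realize_eqF] at this
  exact this

/-- The value of a function symbol is bounded by a term, monotonically in the arguments. -/
theorem exists_bound_func {n : ℕ} (f : TCFunc n) : ∃ b : LTC.Term (Fin n),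
    ∀ (M : Type) [LTC.Structure M] [M ⊨ baseTheory] (v v' : Fin n → M), (∀ i, v i ≤ v' i) →
      app f v ≤ b.realize v' := by
  induction f with
  | zero =>
    refine ⟨0, fun M _ _ v v' h => ?_⟩
    rw [realize_zero, Subsingleton.elim v ![] ]
    exact le_refl (0 : M)
  | succ =>
    refine ⟨S (.var 0), fun M _ _ v v' h => ?_⟩
    rw [realize_S, Term.realize_var, vec_eq_one v, msucc_eq]
    exact (msucc_eq (v 0)).le.trans ((add_le_add_iff_right _).2 (h 0))
  | add =>
    refine ⟨.var 0 + .var 1, fun M _ _ v v' h => ?_⟩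
    rw [realize_add, vec_eq_two v]
    exact add_le_add (h 0) (h 1)
  | mul =>
    refine ⟨.var 0 * .var 1, fun M _ _ v v' h => ?_⟩
    rw [realize_mul, vec_eq_two v]
    exact mul_le_mul' (h 0) (h 1)
  | half =>
    refine ⟨.var 0, fun M _ _ v v' h => ?_⟩
    rw [vec_eq_one v]
    exact (m_half_le (v 0)).trans (h 0)
  | len =>
    refine ⟨len (.var 0), fun M _ _ v v' h => ?_⟩
    rw [realize_len, vec_eq_one v]
    exact m_len_mono (h 0)
  | smash =>
    refine ⟨smash (.var 0) (.var 1) + smash (.var 0) (.var 1) + S 0, fun M _ _ v v' h => ?_⟩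
    simp only [realize_add, realize_smash, realize_S, realize_zero, msucc_eq, zero_add,
      Term.realize_var]
    rw [vec_eq_two v]
    -- Only the length `|x| * |y| + 1` is compared; doubling and adding one in the bound pays for
    -- the return to values.
    refine m_le_of_len_le (u := msmash (v 0) (v 1)) ?_
    rw [Ax.len_smash, Ax.len_smash, msucc_eq, msucc_eq, add_le_add_iff_right]
    exact mul_le_mul' (m_len_mono (h 0)) (m_len_mono (h 1))
  | msp =>
    refine ⟨.var 0, fun M _ _ v v' h => ?_⟩
    rw [vec_eq_two v]
    exact (m_msp_le (v 0) (v 1)).trans (h 0)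
  | monus =>
    refine ⟨.var 0, fun M _ _ v v' h => ?_⟩
    rw [vec_eq_two v]
    exact (m_monus_le (v 0) (v 1)).trans (h 0)
  | proj i =>
    refine ⟨.var i, fun M _ _ v v' h => ?_⟩
    rw [app_proj]; exact h i
  | comp f g ihf ihg =>
    obtain ⟨bf, hf⟩ := ihf
    choose bg hg using ihg
    refine ⟨bf.subst bg, fun M _ _ v v' h => ?_⟩
    rw [app_comp, Term.realize_subst]
    exact hf M _ _ fun i => hg i M v v' h
  | bits f ih =>
    refine ⟨.var 0 + .var 0 + S 0, fun M _ _ v v' h => ?_⟩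
    simp only [realize_add, realize_S, realize_zero, msucc_eq, zero_add, Term.realize_var]
    rw [← Fin.cons_self_tail v]
    exact m_le_of_len_le ((m_bits_len f _ _).trans (m_len_mono (h 0)))
  | least f ih =>
    refine ⟨len (.var 0), fun M _ _ v v' h => ?_⟩
    rw [realize_len, ← Fin.cons_self_tail v]
    exact (m_least_le f _ _).trans (m_len_mono (h 0))

theorem exists_bound {α : Type} (t : LTC.Term α) : ∃ b : LTC.Term α,
    ∀ (M : Type) [LTC.Structure M] [M ⊨ baseTheory] (v v' : α → M), (∀ i, v i ≤ v' i) →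
      t.realize v ≤ b.realize v' := by
  induction t with
  | var a => exact ⟨.var a, fun M _ _ v v' h => h a⟩
  | func f ts ih =>
    choose b hb using ih
    obtain ⟨c, hc⟩ := exists_bound_func f
    refine ⟨c.subst b, fun M _ _ v v' h => ?_⟩
    rw [Term.realize_subst]
    exact hc M _ _ fun i => hb i M v v' h

end Arithmetic

/-! ### Simultaneous substitution for free and bound variables -/

section Substitution

variable {α β : Type}

/-- The extension of a substitution to one more bound variable, which it fixes. -/
def liftSubst {n m : ℕ} (σ : α ⊕ Fin n → LTC.Term (β ⊕ Fin m)) :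
    α ⊕ Fin (n + 1) → LTC.Term (β ⊕ Fin (m + 1)) :=
  Sum.elim (fun a => liftTerm (σ (.inl a)))
    (Fin.snoc (fun i => liftTerm (σ (.inr i))) (.var (.inr (Fin.last m))))

/-- Substitution of terms for all the variables, free and bound, of a formula. -/
def substVars : ∀ {n : ℕ}, LTC.BoundedFormula α n → ∀ {m : ℕ},
    (α ⊕ Fin n → LTC.Term (β ⊕ Fin m)) → LTC.BoundedFormula β m
  | _, .falsum, _, _ => .falsum
  | _, .equal s t, _, σ => .equal (s.subst σ) (t.subst σ)
  | _, .rel R ts, _, σ => .rel R fun i => (ts i).subst σ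
  | _, .imp φ ψ, _, σ => .imp (substVars φ σ) (substVars ψ σ)
  | _, .all φ, _, σ => .all (substVars φ (liftSubst σ))

theorem liftTerm_subst {n m : ℕ} (σ : α ⊕ Fin n → LTC.Term (β ⊕ Fin m))
    (t : LTC.Term (α ⊕ Fin n)) : (liftTerm t).subst (liftSubst σ) = liftTerm (t.subst σ) := by
  induction t with
  | var a => rcases a with a | i <;> simp [liftTerm, liftSubst]
  | func f ts ih =>
    simp only [liftTerm, Term.relabel, Term.subst] at ih ⊢
    simp only [ih]

theorem len_subst {n m : ℕ} (σ : α ⊕ Fin n → LTC.Term (β ⊕ Fin m))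
    (t : LTC.Term (α ⊕ Fin n)) : (len t).subst σ = len (t.subst σ) := by
  simp only [len, fn, Term.subst]
  congr 1; funext i; fin_cases i; rfl

theorem substVars_lastLe {n m : ℕ} (σ : α ⊕ Fin n → LTC.Term (β ⊕ Fin m))
    (t : LTC.Term (α ⊕ Fin n)) :
    substVars (lastLe t) (liftSubst σ) = lastLe (t.subst σ) := by
  simp only [lastLe, Relations.boundedFormula₂, Relations.boundedFormula, substVars]
  congr 1; funext i; fin_cases i
  · simp [liftSubst]
  · exact liftTerm_subst σ t

theorem substVars_bdAll {n m : ℕ} (σ : α ⊕ Fin n → LTC.Term (β ⊕ Fin m))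
    (t : LTC.Term (α ⊕ Fin n)) (φ : LTC.BoundedFormula α (n + 1)) :
    substVars (bdAll t φ) σ = bdAll (t.subst σ) (substVars φ (liftSubst σ)) := by
  rw [bdAll, bdAll, ← substVars_lastLe]; rfl

theorem substVars_bdEx {n m : ℕ} (σ : α ⊕ Fin n → LTC.Term (β ⊕ Fin m))
    (t : LTC.Term (α ⊕ Fin n)) (φ : LTC.BoundedFormula α (n + 1)) :
    substVars (bdEx t φ) σ = bdEx (t.subst σ) (substVars φ (liftSubst σ)) := by
  rw [bdEx, bdEx, ← substVars_lastLe]; rfl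

variable {M : Type} [LTC.Structure M]

theorem realize_liftTerm {n : ℕ} (t : LTC.Term (α ⊕ Fin n)) (v : α → M) (xs : Fin n → M) (a : M) :
    (liftTerm t).realize (Sum.elim v (Fin.snoc xs a : Fin (n + 1) → M)) =
      t.realize (Sum.elim v xs) := by
  rw [liftTerm, Term.realize_relabel]
  congr 1
  funext x
  rcases x with x | x <;> simp

theorem realize_snoc {n : ℕ} (ts : Fin n → LTC.Term α) (t : LTC.Term α) (v : α → M) :
    (fun i => ((Fin.snoc ts t : Fin (n + 1) → LTC.Term α) i).realize v) =
      (Fin.snoc (fun i => (ts i).realize v) (t.realize v) : Fin (n + 1) → M) := by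
  funext i
  refine Fin.lastCases ?_ (fun i => ?_) i <;> simp

theorem realize_substVars {n : ℕ} (φ : LTC.BoundedFormula α n) : ∀ {m : ℕ}
    (σ : α ⊕ Fin n → LTC.Term (β ⊕ Fin m)) (v : β → M) (xs : Fin m → M),
    (substVars φ σ).Realize v xs ↔
      φ.Realize (fun a => (σ (.inl a)).realize (Sum.elim v xs))
        (fun i => (σ (.inr i)).realize (Sum.elim v xs)) := by
  have key {n m : ℕ} (σ : α ⊕ Fin n → LTC.Term (β ⊕ Fin m)) (v : β → M) (xs : Fin m → M) :
      (fun a => (σ a).realize (Sum.elim v xs)) =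
        Sum.elim (fun a => (σ (.inl a)).realize (Sum.elim v xs))
          (fun i => (σ (.inr i)).realize (Sum.elim v xs)) := by
    funext a; rcases a with a | i <;> rfl
  induction φ with
  | falsum => intro m σ v xs; exact Iff.rfl
  | equal s t =>
    intro m σ v xs
    simp only [substVars, BoundedFormula.Realize, Term.realize_subst, key]
  | rel R ts =>
    intro m σ v xs
    simp only [substVars, BoundedFormula.Realize, Term.realize_subst, key]
  | imp φ ψ ih₁ ih₂ =>
    intro m σ v xs
    simp only [substVars, BoundedFormula.Realize, ih₁, ih₂]
  | all φ ih =>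
    intro m σ v xs
    simp only [substVars, BoundedFormula.Realize, ih]
    refine forall_congr' fun a => ?_
    simp only [liftSubst, Sum.elim_inl, Sum.elim_inr, realize_snoc, realize_liftTerm,
      Term.realize_var, Fin.snoc_last]

/-- Substitution of terms for the bound variables. -/
def substB {n m : ℕ} (φ : LTC.BoundedFormula α n) (ts : Fin n → LTC.Term (α ⊕ Fin m)) :
    LTC.BoundedFormula α m :=
  substVars φ (Sum.elim (fun a => .var (.inl a)) ts)

theorem realize_substB {n m : ℕ} {φ : LTC.BoundedFormula α n}
    {ts : Fin n → LTC.Term (α ⊕ Fin m)} {v : α → M} {xs : Fin m → M} :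
    (substB φ ts).Realize v xs ↔ φ.Realize v fun i => (ts i).realize (Sum.elim v xs) :=
  realize_substVars _ _ _ _

/-- Weakening by a new last bound variable. -/
def weaken {n : ℕ} (φ : LTC.BoundedFormula α n) : LTC.BoundedFormula α (n + 1) :=
  substB φ fun i => .var (.inr i.castSucc)

theorem realize_weaken {n : ℕ} {φ : LTC.BoundedFormula α n} {v : α → M} {xs : Fin n → M} {a : M} :
    (weaken φ).Realize v (Fin.snoc xs a) ↔ φ.Realize v xs := by
  rw [weaken, realize_substB]
  simp

attribute [local instance] leOf

/-- The atomic formula `s ≤ t`. -/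
def bdLe {n : ℕ} (s t : LTC.Term (α ⊕ Fin n)) : LTC.BoundedFormula α n :=
  Relations.boundedFormula₂ (L := LTC) TCRel.le s t

theorem realize_bdLe {n : ℕ} {s t : LTC.Term (α ⊕ Fin n)} {v : α → M} {xs : Fin n → M} :
    (bdLe s t).Realize v xs ↔ s.realize (Sum.elim v xs) ≤ t.realize (Sum.elim v xs) := by
  rw [bdLe, BoundedFormula.realize_rel₂]; rfl

theorem realize_bdAll {n : ℕ} {t : LTC.Term (α ⊕ Fin n)} {φ : LTC.BoundedFormula α (n + 1)}
    {v : α → M} {xs : Fin n → M} : (bdAll t φ).Realize v xs ↔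
      ∀ z : M, z ≤ t.realize (Sum.elim v xs) → φ.Realize v (Fin.snoc xs z) := by
  simp only [bdAll, BoundedFormula.realize_all, BoundedFormula.realize_imp]
  refine forall_congr' fun z => ?_
  have := realize_bdLe (s := .var (.inr (Fin.last n))) (t := liftTerm t) (v := v)
    (xs := (Fin.snoc xs z : Fin (n + 1) → M))
  rw [realize_liftTerm, Term.realize_var, Sum.elim_inr, Fin.snoc_last] at this
  exact imp_congr this Iff.rfl

theorem realize_bdEx {n : ℕ} {t : LTC.Term (α ⊕ Fin n)} {φ : LTC.BoundedFormula α (n + 1)}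
    {v : α → M} {xs : Fin n → M} : (bdEx t φ).Realize v xs ↔
      ∃ z : M, z ≤ t.realize (Sum.elim v xs) ∧ φ.Realize v (Fin.snoc xs z) := by
  simp only [bdEx, BoundedFormula.realize_ex, BoundedFormula.realize_inf]
  refine exists_congr fun z => ?_
  have := realize_bdLe (s := .var (.inr (Fin.last n))) (t := liftTerm t) (v := v)
    (xs := (Fin.snoc xs z : Fin (n + 1) → M))
  rw [realize_liftTerm, Term.realize_var, Sum.elim_inr, Fin.snoc_last] at this
  exact and_congr this Iff.rfl

end Substitution

/-! ### Closure properties of the formula classes -/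

section ClassClosure

variable {α β : Type}

theorem sigmaHat_succ (j : ℕ) : (SigmaHat (j + 1) : FormulaClass α) = BdExBlock (PiHat j) := rfl

theorem piHat_succ (j : ℕ) : (PiHat (j + 1) : FormulaClass α) = BdAllBlock (SigmaHat j) := rfl

theorem BdExBlock.mono {K K' : FormulaClass α} (h : ∀ n φ, K n φ → K' n φ) {n : ℕ}
    {φ : LTC.BoundedFormula α n} (hφ : BdExBlock K n φ) : BdExBlock K' n φ := by
  induction hφ with
  | base h' => exact .base (h _ _ h')
  | ex t _ ih => exact .ex t ih

theorem BdAllBlock.mono {K K' : FormulaClass α} (h : ∀ n φ, K n φ → K' n φ) {n : ℕ}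
    {φ : LTC.BoundedFormula α n} (hφ : BdAllBlock K n φ) : BdAllBlock K' n φ := by
  induction hφ with
  | base h' => exact .base (h _ _ h')
  | all t _ ih => exact .all t ih

/-- The additional empty block is inserted innermost, so the type of the leading block is unchanged.
-/
theorem hat_mono (j : ℕ) :
    (∀ n (φ : LTC.BoundedFormula α n), SigmaHat j n φ → SigmaHat (j + 1) n φ) ∧
    ∀ n (φ : LTC.BoundedFormula α n), PiHat j n φ → PiHat (j + 1) n φ := by
  induction j with
  | zero => exact ⟨fun n φ h => .base h, fun n φ h => .base h⟩
  | succ j ih =>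
    exact ⟨fun n φ h => BdExBlock.mono ih.2 h, fun n φ h => BdAllBlock.mono ih.1 h⟩

theorem IsSharplyBounded.substVars {n : ℕ} {φ : LTC.BoundedFormula α n}
    (h : IsSharplyBounded φ) : ∀ {m : ℕ} (σ : α ⊕ Fin n → LTC.Term (β ⊕ Fin m)),
    IsSharplyBounded (BoundedArith.substVars φ σ) := by
  induction h with
  | falsum => intro m σ; exact .falsum
  | atomic h =>
    intro m σ
    cases h with
    | equal s t => exact .atomic (.equal _ _)
    | rel R ts => exact .atomic (.rel _ _)
  | imp _ _ ih₁ ih₂ => intro m σ; exact .imp (ih₁ σ) (ih₂ σ)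
  | all t _ ih => intro m σ; rw [substVars_bdAll, len_subst]; exact .all _ (ih _)
  | ex t _ ih => intro m σ; rw [substVars_bdEx, len_subst]; exact .ex _ (ih _)

theorem hat_substVars (j : ℕ) :
    (∀ {n m : ℕ} (φ : LTC.BoundedFormula α n) (σ : α ⊕ Fin n → LTC.Term (β ⊕ Fin m)),
      SigmaHat j n φ → SigmaHat j m (substVars φ σ)) ∧
    ∀ {n m : ℕ} (φ : LTC.BoundedFormula α n) (σ : α ⊕ Fin n → LTC.Term (β ⊕ Fin m)),
      PiHat j n φ → PiHat j m (substVars φ σ) := by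
  induction j with
  | zero => exact ⟨fun φ σ h => IsSharplyBounded.substVars h σ,
      fun φ σ h => IsSharplyBounded.substVars h σ⟩
  | succ j ih =>
    constructor
    · intro n m φ σ h
      rw [sigmaHat_succ] at h ⊢
      induction h generalizing m with
      | base h => exact .base (ih.2 _ σ h)
      | ex t _ ih' => rw [substVars_bdEx]; exact .ex _ (ih' _)
    · intro n m φ σ h
      rw [piHat_succ] at h ⊢
      induction h generalizing m with
      | base h => exact .base (ih.1 _ σ h)
      | all t _ ih' => rw [substVars_bdAll]; exact .all _ (ih' _)

theorem IsSharplyBounded.not {n : ℕ} {φ : LTC.BoundedFormula α n} (h : IsSharplyBounded φ) :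
    IsSharplyBounded (∼φ) := .imp h .falsum

theorem IsSharplyBounded.sup {n : ℕ} {φ ψ : LTC.BoundedFormula α n} (hφ : IsSharplyBounded φ)
    (hψ : IsSharplyBounded ψ) : IsSharplyBounded (φ ⊔ ψ) := .imp hφ.not hψ

theorem IsSharplyBounded.inf {n : ℕ} {φ ψ : LTC.BoundedFormula α n} (hφ : IsSharplyBounded φ)
    (hψ : IsSharplyBounded ψ) : IsSharplyBounded (φ ⊓ ψ) := .not (.imp hφ hψ.not)

theorem isSharplyBounded_bdLe {n : ℕ} (s t : LTC.Term (α ⊕ Fin n)) :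
    IsSharplyBounded (bdLe s t) := .atomic (.rel _ _)

/-- Equivalence over the base theory. -/
def BEquiv {n : ℕ} (φ ψ : LTC.BoundedFormula α n) : Prop :=
  ∀ (M : Type) [LTC.Structure M] [M ⊨ baseTheory] (v : α → M) (xs : Fin n → M),
    φ.Realize v xs ↔ ψ.Realize v xs

/-- `φ` is equivalent over the base theory to a formula in `K`. -/
def UpToEquiv (K : FormulaClass α) : FormulaClass α := fun n φ => ∃ ψ, K n ψ ∧ BEquiv φ ψ

theorem UpToEquiv.of {K : FormulaClass α} {n : ℕ} {φ : LTC.BoundedFormula α n} (h : K n φ) :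
    UpToEquiv K n φ := ⟨φ, h, fun _ _ _ _ _ => Iff.rfl⟩

theorem UpToEquiv.congr {K : FormulaClass α} {n : ℕ} {φ ψ : LTC.BoundedFormula α n}
    (h : UpToEquiv K n ψ) (he : BEquiv φ ψ) : UpToEquiv K n φ := by
  obtain ⟨χ, hχ, h'⟩ := h
  exact ⟨χ, hχ, fun M _ _ v xs => (he M v xs).trans (h' M v xs)⟩

theorem hat_not (j : ℕ) :
    (∀ {n : ℕ} {φ : LTC.BoundedFormula α n}, SigmaHat j n φ → UpToEquiv (PiHat j) n (∼φ)) ∧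
    ∀ {n : ℕ} {φ : LTC.BoundedFormula α n}, PiHat j n φ → UpToEquiv (SigmaHat j) n (∼φ) := by
  induction j with
  | zero => exact ⟨fun h => .of (IsSharplyBounded.not h), fun h => .of (IsSharplyBounded.not h)⟩
  | succ j ih =>
    constructor
    · intro n φ h
      rw [sigmaHat_succ] at h
      induction h with
      | base h =>
        obtain ⟨ψ, hψ, he⟩ := ih.2 h
        exact ⟨ψ, .base hψ, he⟩
      | ex t _ ih' =>
        obtain ⟨ψ, hψ, he⟩ := ih'
        refine ⟨bdAll t ψ, .all t hψ, fun M _ _ v xs => ?_⟩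
        simp only [BoundedFormula.realize_not, realize_bdEx, realize_bdAll, ← he M, not_exists,
          not_and]
    · intro n φ h
      rw [piHat_succ] at h
      induction h with
      | base h =>
        obtain ⟨ψ, hψ, he⟩ := ih.1 h
        exact ⟨ψ, .base hψ, he⟩
      | all t _ ih' =>
        obtain ⟨ψ, hψ, he⟩ := ih'
        refine ⟨bdEx t ψ, .ex t hψ, fun M _ _ v xs => ?_⟩
        simp only [BoundedFormula.realize_not, realize_bdEx, realize_bdAll, ← he M, not_forall,
          exists_prop]

/-- Closure under disjunction, up to equivalence. -/
def SupClosed (K : FormulaClass α) : Prop :=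
  ∀ {n : ℕ} {φ ψ : LTC.BoundedFormula α n}, K n φ → K n ψ → UpToEquiv K n (φ ⊔ ψ)

/-- Closure under weakening by a bound variable. -/
def WeakenClosed (K : FormulaClass α) : Prop :=
  ∀ {n : ℕ} {φ : LTC.BoundedFormula α n}, K n φ → K (n + 1) (weaken φ)

/-- Prenexing: the quantifiers of the first disjunct are pulled out over a disjunct in `K`, then
those of the second, with weakening at every step. -/
theorem bdAllBlock_supClosed {K : FormulaClass α} (hK : SupClosed K) (hw : WeakenClosed K)
    (hw' : WeakenClosed (BdAllBlock K)) : SupClosed (BdAllBlock K) := by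
  have h₁ {n : ℕ} {φ ψ : LTC.BoundedFormula α n} (hφ : BdAllBlock K n φ) (hψ : K n ψ) :
      UpToEquiv (BdAllBlock K) n (φ ⊔ ψ) := by
    induction hφ with
    | base h =>
      obtain ⟨χ, hχ, he⟩ := hK h hψ
      exact ⟨χ, .base hχ, he⟩
    | all t _ ih =>
      obtain ⟨χ, hχ, he⟩ := ih (hw hψ)
      refine ⟨bdAll t χ, .all t hχ, fun M _ _ v xs => ?_⟩
      simp only [BoundedFormula.realize_sup, realize_bdAll, ← he M, realize_weaken]
      simp only [forall_or_right]
  intro n φ ψ hφ hψ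
  induction hψ with
  | base h => exact h₁ hφ h
  | all t _ ih =>
    obtain ⟨χ, hχ, he⟩ := ih (hw' hφ)
    refine ⟨bdAll t χ, .all t hχ, fun M _ _ v xs => ?_⟩
    simp only [BoundedFormula.realize_sup, realize_bdAll, ← he M, realize_weaken]
    simp only [forall_or_left]

theorem bdExBlock_supClosed {K : FormulaClass α} (hK : SupClosed K) (hw : WeakenClosed K)
    (hw' : WeakenClosed (BdExBlock K)) : SupClosed (BdExBlock K) := by
  have h₁ {n : ℕ} {φ ψ : LTC.BoundedFormula α n} (hφ : BdExBlock K n φ) (hψ : K n ψ) :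
      UpToEquiv (BdExBlock K) n (φ ⊔ ψ) := by
    induction hφ with
    | base h =>
      obtain ⟨χ, hχ, he⟩ := hK h hψ
      exact ⟨χ, .base hχ, he⟩
    | ex t _ ih =>
      obtain ⟨χ, hχ, he⟩ := ih (hw hψ)
      refine ⟨bdEx t χ, .ex t hχ, fun M _ _ v xs => ?_⟩
      simp only [BoundedFormula.realize_sup, realize_bdEx, ← he M, realize_weaken]
      simp only [and_or_left, exists_or, exists_and_right]
      -- Pulling an existential quantifier over a disjunct needs a nonempty range; `0` lies below
      -- every bound.
      rw [and_iff_right ⟨_, Ax.zero_le _⟩]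
  intro n φ ψ hφ hψ
  induction hψ with
  | base h => exact h₁ hφ h
  | ex t _ ih =>
    obtain ⟨χ, hχ, he⟩ := ih (hw' hφ)
    refine ⟨bdEx t χ, .ex t hχ, fun M _ _ v xs => ?_⟩
    simp only [BoundedFormula.realize_sup, realize_bdEx, ← he M, realize_weaken]
    simp only [and_or_left, exists_or, exists_and_right]
    rw [and_iff_right ⟨_, Ax.zero_le _⟩]

theorem hat_weakenClosed (j : ℕ) :
    WeakenClosed (SigmaHat j : FormulaClass α) ∧ WeakenClosed (PiHat j : FormulaClass α) :=
  ⟨fun h => (hat_substVars j).1 _ _ h, fun h => (hat_substVars j).2 _ _ h⟩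

theorem hat_supClosed (j : ℕ) :
    SupClosed (SigmaHat j : FormulaClass α) ∧ SupClosed (PiHat j : FormulaClass α) := by
  induction j with
  | zero => exact ⟨fun h h' => .of (IsSharplyBounded.sup h h'),
      fun h h' => .of (IsSharplyBounded.sup h h')⟩
  | succ j ih =>
    exact ⟨bdExBlock_supClosed ih.2 (hat_weakenClosed j).2 (hat_weakenClosed (j + 1)).1,
      bdAllBlock_supClosed ih.1 (hat_weakenClosed j).1 (hat_weakenClosed (j + 1)).2⟩

/-- The formulas equivalent over the base theory to a `Π̂ⱼ` formula. -/
abbrev PiDef (j : ℕ) : FormulaClass α := UpToEquiv (PiHat j)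

/-- The formulas equivalent over the base theory to a `Σ̂ⱼ` formula. -/
abbrev SigmaDef (j : ℕ) : FormulaClass α := UpToEquiv (SigmaHat j)

variable {n : ℕ} {φ ψ : LTC.BoundedFormula α n} {j : ℕ}

theorem SigmaDef.not (h : SigmaDef j n φ) : PiDef j n (∼φ) := by
  obtain ⟨χ, hχ, he⟩ := h
  exact ((hat_not j).1 hχ).congr fun M _ _ v xs => not_congr (he M v xs)

theorem PiDef.not (h : PiDef j n φ) : SigmaDef j n (∼φ) := by
  obtain ⟨χ, hχ, he⟩ := h
  exact ((hat_not j).2 hχ).congr fun M _ _ v xs => not_congr (he M v xs)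

theorem PiDef.sup (hφ : PiDef j n φ) (hψ : PiDef j n ψ) : PiDef j n (φ ⊔ ψ) := by
  obtain ⟨φ', hφ', h₁⟩ := hφ
  obtain ⟨ψ', hψ', h₂⟩ := hψ
  refine ((hat_supClosed j).2 hφ' hψ').congr fun M _ _ v xs => ?_
  simp only [BoundedFormula.realize_sup, h₁ M, h₂ M]

theorem SigmaDef.sup (hφ : SigmaDef j n φ) (hψ : SigmaDef j n ψ) : SigmaDef j n (φ ⊔ ψ) := by
  obtain ⟨φ', hφ', h₁⟩ := hφ
  obtain ⟨ψ', hψ', h₂⟩ := hψ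
  refine ((hat_supClosed j).1 hφ' hψ').congr fun M _ _ v xs => ?_
  simp only [BoundedFormula.realize_sup, h₁ M, h₂ M]

theorem PiDef.inf (hφ : PiDef j n φ) (hψ : PiDef j n ψ) : PiDef j n (φ ⊓ ψ) := by
  refine (hφ.not.sup hψ.not).not.congr fun M _ _ v xs => ?_
  simp only [BoundedFormula.realize_inf, BoundedFormula.realize_not, BoundedFormula.realize_sup]
  tauto

theorem PiDef.of_isSharplyBounded (h : IsSharplyBounded φ) : PiDef j n φ := by
  refine .of ?_
  induction j with
  | zero => exact h
  | succ j ih => exact (hat_mono j).2 _ _ ih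

theorem PiDef.bdLe (s t : LTC.Term (α ⊕ Fin n)) : PiDef j n (bdLe s t) :=
  .of_isSharplyBounded (isSharplyBounded_bdLe s t)

theorem PiDef.bdEqual (s t : LTC.Term (α ⊕ Fin n)) : PiDef j n (s.bdEqual t) :=
  .of_isSharplyBounded (.atomic (.equal _ _))

theorem PiDef.substVars {m : ℕ} (σ : α ⊕ Fin n → LTC.Term (β ⊕ Fin m)) (h : PiDef j n φ) :
    PiDef j m (substVars φ σ) := by
  obtain ⟨χ, hχ, he⟩ := h
  exact ⟨_, (hat_substVars j).2 χ σ hχ, fun M _ _ v xs => by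
    rw [realize_substVars, realize_substVars, he M]⟩

theorem PiDef.substB {m : ℕ} (ts : Fin n → LTC.Term (α ⊕ Fin m)) (h : PiDef j n φ) :
    PiDef j m (substB φ ts) := h.substVars _

theorem PiDef.succ (h : PiDef j n φ) : PiDef (j + 1) n φ := by
  obtain ⟨χ, hχ, he⟩ := h
  exact ⟨χ, (hat_mono j).2 _ _ hχ, he⟩

end ClassClosure

/-! ### Contracting blocks of existential quantifiers -/

section Contraction

attribute [local instance] zeroOf oneOf addOf mulOf leOf addMonoidOf linearOrderOf
  isOrderedCancelAddMonoid semiringOf isStrictOrderedRing canonicallyOrderedAdd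

variable {α : Type}

theorem snoc_le_snoc {R : Type} [Preorder R] {n : ℕ} {v : α → R} {xs : Fin n → R} {y z : R}
    (h : y ≤ z) (a : α ⊕ Fin (n + 1)) : Sum.elim v (Fin.snoc xs y : Fin (n + 1) → R) a ≤
      Sum.elim v (Fin.snoc xs z : Fin (n + 1) → R) a := by
  rcases a with a | i
  · exact le_rfl
  · refine Fin.lastCases ?_ (fun i => ?_) i <;> simp [h]

/-- A term with its last bound variable substituted. -/
def substLastT {n m : ℕ} (t : LTC.Term (α ⊕ Fin (n + 1)))
    (ts : Fin n → LTC.Term (α ⊕ Fin m)) (s : LTC.Term (α ⊕ Fin m)) : LTC.Term (α ⊕ Fin m) :=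
  t.subst (Sum.elim (fun a => .var (.inl a)) (Fin.snoc ts s))

theorem realize_substLastT {M : Type} [LTC.Structure M] {n m : ℕ}
    {t : LTC.Term (α ⊕ Fin (n + 1))} {ts : Fin n → LTC.Term (α ⊕ Fin m)}
    {s : LTC.Term (α ⊕ Fin m)} {v : α → M} {xs : Fin m → M} :
    (substLastT t ts s).realize (Sum.elim v xs) =
      t.realize (Sum.elim v (Fin.snoc (fun i => (ts i).realize (Sum.elim v xs))
        (s.realize (Sum.elim v xs)) : Fin (n + 1) → M)) := by
  rw [substLastT, Term.realize_subst]
  congr 1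
  funext a
  rcases a with a | i
  · rfl
  · refine Fin.lastCases ?_ (fun i => ?_) i <;> simp

/-- The bound variables except the last one. -/
def initVars (n : ℕ) : Fin n → LTC.Term (α ⊕ Fin (n + 1)) := fun i => .var (.inr i.castSucc)

/-- The last bound variable. -/
def lastVar (n : ℕ) : LTC.Term (α ⊕ Fin (n + 1)) := .var (.inr (Fin.last n))

@[simp] theorem realize_initVars {M : Type} [LTC.Structure M] {n : ℕ} (v : α → M) (xs : Fin n → M)
    (y : M) (i : Fin n) :
    (initVars n i).realize (Sum.elim v (Fin.snoc xs y : Fin (n + 1) → M)) = xs i := by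
  simp [initVars]

@[simp] theorem realize_lastVar {M : Type} [LTC.Structure M] {n : ℕ} (v : α → M) (xs : Fin n → M)
    (y : M) : (lastVar n).realize (Sum.elim v (Fin.snoc xs y : Fin (n + 1) → M)) = y := by
  simp [lastVar]

/-- The formula `φ (xs, fst w, snd w)`. -/
def unpair {n : ℕ} (φ : LTC.BoundedFormula α (n + 2)) : LTC.BoundedFormula α (n + 1) :=
  substB φ (Fin.snoc (Fin.snoc (initVars n) (fstT (lastVar n))) (sndT (lastVar n)))

theorem realize_unpair {M : Type} [LTC.Structure M] {n : ℕ} {φ : LTC.BoundedFormula α (n + 2)}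
    {v : α → M} {xs : Fin n → M} {w : M} : (unpair φ).Realize v (Fin.snoc xs w) ↔
      φ.Realize v (Fin.snoc (Fin.snoc xs (mfst w)) (msnd w)) := by
  rw [unpair, realize_substB, realize_snoc, realize_snoc]
  simp

/-- Over the base theory, a `Σ̂_{j+1}` formula has a single existential quantifier in front. -/
theorem SigmaHat.exists_contraction {j n : ℕ} {φ : LTC.BoundedFormula α n}
    (h : SigmaHat (j + 1) n φ) : ∃ (t : LTC.Term (α ⊕ Fin n)) (θ : LTC.BoundedFormula α (n + 1)),
      PiDef j (n + 1) θ ∧ ∀ (M : Type) [LTC.Structure M] [M ⊨ baseTheory] (v : α → M)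
        (xs : Fin n → M), φ.Realize v xs ↔
          ∃ z, z ≤ t.realize (Sum.elim v xs) ∧ θ.Realize v (Fin.snoc xs z) := by
  rw [sigmaHat_succ] at h
  induction h with
  | base h =>
    -- An empty block receives a dummy quantifier bounded by `0`.
    refine ⟨0, _, PiDef.substB (initVars _) (.of h), fun M _ _ v xs => ?_⟩
    simp only [realize_substB, realize_initVars]
    exact ⟨fun h => ⟨0, by simp, h⟩, fun ⟨_, _, h⟩ => h⟩
  | @ex n s φ _ ih =>
    obtain ⟨t, θ, hθ, he⟩ := ih
    obtain ⟨b, hb⟩ := exists_bound t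
    -- `q` bounds `y + z`, because `z ≤ t (y) ≤ b (s)` for `y ≤ s`. The pair code has length `2 |y +
    -- z| + 1`, at most the length of `B = q # 3`, hence value at most `2 B + 1`.
    let q : LTC.Term (α ⊕ Fin n) := s + substLastT b (fun i => .var (.inr i)) s
    let B : LTC.Term (α ⊕ Fin n) := smash q (S (S (S 0)))
    refine ⟨B + B + S 0, bdLe (fstT (lastVar n)) (liftTerm s) ⊓
        bdLe (sndT (lastVar n)) (substLastT t (initVars n) (fstT (lastVar n))) ⊓ unpair θ,
      ((PiDef.bdLe _ _).inf (PiDef.bdLe _ _)).inf (hθ.substB _), fun M _ _ v xs => ?_⟩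
    simp only [realize_bdEx, BoundedFormula.realize_inf, realize_bdLe, realize_unpair,
      realize_liftTerm, realize_substLastT, realize_fstT, realize_sndT, realize_lastVar,
      realize_initVars, he M]
    constructor
    · rintro ⟨y, hy, z, hz, h⟩
      obtain ⟨w, rfl, rfl, hw⟩ := m_exists_pair y z
      refine ⟨w, ?_, ⟨hy, hz⟩, h⟩
      simp only [B, realize_add, realize_smash, realize_S, realize_zero, msucc_eq, zero_add]
      refine m_le_of_len_le ?_
      rw [m_len_smash_three, hw]
      have hq : mfst w + msnd w ≤ q.realize (Sum.elim v xs) := by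
        rw [realize_add, realize_substLastT]
        exact add_le_add hy (hz.trans (hb M _ _ (snoc_le_snoc hy)))
      have := m_len_mono hq
      gcongr
    · rintro ⟨w, -, ⟨hy, hz⟩, h⟩
      exact ⟨_, hy, _, hz, h⟩

/-- Over the base theory, an `∃Σ̂_{j+1}` formula is equivalent to `∃ z θ` with `θ` in `Π̂ⱼ`. -/
theorem ExBlock.exists_contraction {j n : ℕ} {φ : LTC.BoundedFormula α n}
    (h : ExBlock (SigmaHat (j + 1)) n φ) : ∃ θ : LTC.BoundedFormula α (n + 1),
      PiDef j (n + 1) θ ∧ ∀ (M : Type) [LTC.Structure M] [M ⊨ baseTheory] (v : α → M)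
        (xs : Fin n → M), φ.Realize v xs ↔ ∃ z, θ.Realize v (Fin.snoc xs z) := by
  induction h with
  | base h =>
    obtain ⟨t, θ, hθ, he⟩ := SigmaHat.exists_contraction h
    refine ⟨bdLe (lastVar _) (liftTerm t) ⊓ θ, (PiDef.bdLe _ _).inf hθ, fun M _ _ v xs => ?_⟩
    simp only [he M, BoundedFormula.realize_inf, realize_bdLe, realize_lastVar, realize_liftTerm]
  | ex _ ih =>
    obtain ⟨θ, hθ, he⟩ := ih
    refine ⟨unpair θ, hθ.substB _, fun M _ _ v xs => ?_⟩
    simp only [BoundedFormula.realize_ex, he M, realize_unpair]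
    constructor
    · rintro ⟨y, z, h⟩
      obtain ⟨w, rfl, rfl, -⟩ := m_exists_pair y z
      exact ⟨w, h⟩
    · rintro ⟨w, h⟩
      exact ⟨_, _, h⟩

/-- Over the base theory, the negation of an `∃∀Π̂ⱼ` formula is an `∀∃Σ̂ⱼ` formula. -/
theorem ExBlock.exists_not {j n : ℕ} {φ : LTC.BoundedFormula α n}
    (h : ExBlock (AllBlock (PiHat j)) n φ) :
    UpToEquiv (AllBlock (ExBlock (SigmaHat j))) n (∼φ) := by
  have h₁ {n : ℕ} {φ : LTC.BoundedFormula α n} (h : AllBlock (PiHat j) n φ) :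
      UpToEquiv (ExBlock (SigmaHat j)) n (∼φ) := by
    induction h with
    | base h =>
      obtain ⟨ψ, hψ, he⟩ := (hat_not j).2 h
      exact ⟨ψ, .base hψ, he⟩
    | all _ ih =>
      obtain ⟨ψ, hψ, he⟩ := ih
      refine ⟨ψ.ex, .ex hψ, fun M _ _ v xs => ?_⟩
      simp only [BoundedFormula.realize_not, BoundedFormula.realize_all, BoundedFormula.realize_ex,
        ← he M, not_forall]
  induction h with
  | base h =>
    obtain ⟨ψ, hψ, he⟩ := h₁ h
    exact ⟨ψ, .base hψ, he⟩
  | ex _ ih =>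
    obtain ⟨ψ, hψ, he⟩ := ih
    refine ⟨ψ.all, .all hψ, fun M _ _ v xs => ?_⟩
    simp only [BoundedFormula.realize_not, BoundedFormula.realize_all, BoundedFormula.realize_ex,
      ← he M, not_exists]

end Contraction

/-! ### Induction from minimization -/

section Minimization

attribute [local instance] zeroOf oneOf addOf mulOf leOf addMonoidOf linearOrderOf
  isOrderedCancelAddMonoid semiringOf isStrictOrderedRing canonicallyOrderedAdd

variable {M : Type} [LTC.Structure M]

theorem realize_substLast {n : ℕ} {φ : LTC.Formula (Fin (n + 1))}
    {t : LTC.Term (Fin (n + 1)) → LTC.Term (Fin (n + 1))} {y : Fin n → M} {x : M} :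
    (substLast φ t).Realize (Fin.snoc y x : Fin (n + 1) → M) ↔
      φ.Realize (Fin.snoc y ((t (.var (Fin.last n))).realize (Fin.snoc y x : Fin (n + 1) → M)) :
        Fin (n + 1) → M) := by
  rw [substLast, Formula.Realize, BoundedFormula.realize_subst, realize_snoc]
  simp [Formula.Realize]

theorem realize_atZero {n : ℕ} {φ : LTC.Formula (Fin (n + 1))} {y : Fin n → M} :
    (atZero φ).Realize y ↔ φ.Realize (Fin.snoc y 0 : Fin (n + 1) → M) := by
  rw [atZero, Formula.Realize, BoundedFormula.realize_subst, realize_snoc]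
  simp [Formula.Realize]

theorem realize_indAxiom {n : ℕ} {φ : LTC.Formula (Fin (n + 1))} :
    M ⊨ indAxiom φ ↔ ∀ y : Fin n → M, φ.Realize (Fin.snoc y 0 : Fin (n + 1) → M) →
      (∀ x, φ.Realize (Fin.snoc y x : Fin (n + 1) → M) →
        φ.Realize (Fin.snoc y (msucc x) : Fin (n + 1) → M)) →
      ∀ x, φ.Realize (Fin.snoc y x : Fin (n + 1) → M) := by
  simp only [indAxiom, realize_univClosure, Formula.realize_imp, Formula.realize_inf,
    realize_atZero, realize_allLast, realize_substLast, realize_S, Term.realize_var, Fin.snoc_last,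
    and_imp]

theorem realize_pindAxiom {n : ℕ} {φ : LTC.Formula (Fin (n + 1))} :
    M ⊨ pindAxiom φ ↔ ∀ y : Fin n → M, φ.Realize (Fin.snoc y 0 : Fin (n + 1) → M) →
      (∀ x, φ.Realize (Fin.snoc y (mhalf x) : Fin (n + 1) → M) →
        φ.Realize (Fin.snoc y x : Fin (n + 1) → M)) →
      ∀ x, φ.Realize (Fin.snoc y x : Fin (n + 1) → M) := by
  simp only [pindAxiom, realize_univClosure, Formula.realize_imp, Formula.realize_inf,
    realize_atZero, realize_allLast, realize_substLast, realize_half, Term.realize_var,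
    Fin.snoc_last, and_imp]

/-- Free variables turned into bound ones. -/
def bindVars {n : ℕ} (φ : LTC.Formula (Fin n)) : LTC.BoundedFormula Empty n :=
  substVars φ (Sum.elim (fun i => .var (.inr i)) Fin.elim0)

theorem realize_bindVars {n : ℕ} {φ : LTC.Formula (Fin n)} {v : Empty → M} {xs : Fin n → M} :
    (bindVars φ).Realize v xs ↔ φ.Realize xs := by
  rw [bindVars, realize_substVars, Formula.Realize]
  simp only [Sum.elim_inl, Term.realize_var, Sum.elim_inr]
  exact iff_of_eq (congrArg _ (Subsingleton.elim _ _))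

/-- `l ≤ r ∧ z ≤ t (y, x) ∧ θ (y, x, z)` for terms `l`, `r`, `x`, `z` in the variables
`y`, `a`, `w`. -/
def codeF {n : ℕ} (t : LTC.Term (Empty ⊕ Fin (n + 1))) (θ : LTC.BoundedFormula Empty (n + 2))
    (l r x z : LTC.Term (Empty ⊕ Fin (n + 2))) : LTC.BoundedFormula Empty (n + 2) :=
  bdLe l r ⊓ (bdLe z (substLastT t (fun i => .var (.inr i.castSucc.castSucc)) x) ⊓
    substB θ (Fin.snoc (Fin.snoc (fun i => .var (.inr i.castSucc.castSucc)) x) z))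

theorem realize_codeF {n : ℕ} {t : LTC.Term (Empty ⊕ Fin (n + 1))}
    {θ : LTC.BoundedFormula Empty (n + 2)} {l r x z : LTC.Term (Empty ⊕ Fin (n + 2))}
    {v : Empty → M} {y : Fin n → M} {a w : M} :
    let e : Empty ⊕ Fin (n + 2) → M := Sum.elim v (Fin.snoc (Fin.snoc y a : Fin (n + 1) → M) w)
    (codeF t θ l r x z).Realize v (Fin.snoc (Fin.snoc y a : Fin (n + 1) → M) w) ↔
      l.realize e ≤ r.realize e ∧
        (z.realize e ≤ t.realize (Sum.elim v (Fin.snoc y (x.realize e) : Fin (n + 1) → M)) ∧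
          θ.Realize v (Fin.snoc (Fin.snoc y (x.realize e) : Fin (n + 1) → M) (z.realize e))) := by
  intro e
  simp only [codeF, BoundedFormula.realize_inf, realize_bdLe, realize_substLastT, realize_substB,
    realize_snoc, e]
  simp only [Term.realize_var, Sum.elim_inr, Fin.snoc_castSucc]

variable (M) in
/-- Every nonempty set defined by a `Π̂ⱼ` formula with parameters has an `R`-minimal element. -/
def HasMin (j : ℕ) (R : M → M → Prop) : Prop :=
  ∀ {m : ℕ} (Θ : LTC.BoundedFormula Empty (m + 1)), PiDef j (m + 1) Θ →
    ∀ (v : Empty → M) (xs : Fin m → M) (w : M), Θ.Realize v (Fin.snoc xs w) →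
      ∃ c, Θ.Realize v (Fin.snoc xs c) ∧ ∀ d, Θ.Realize v (Fin.snoc xs d) → ¬ R d c

variable [M ⊨ baseTheory]

/-- Otherwise `2 ^ |y| ≤ 2 ^ |x| - 1`; these have lengths `|y| + 1` and `|x|`. -/
theorem m_pow_mono {x y : M} (h : mlen x ≤ mlen y) : mpow x ≤ mpow y := by
  by_contra hlt
  rw [not_le] at hlt
  obtain ⟨c, hc⟩ := m_exists_succ (m_pow_pos x).ne'
  rw [hc, m_lt_add_one_iff] at hlt
  have h1 := m_len_pow_pred x
  rw [hc, m_monus_unique rfl] at h1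
  have h2 := m_len_mono hlt
  rw [m_len_pow, h1] at h2
  exact absurd (h2.trans h) (not_le.2 (m_lt_add_one _))

theorem m_monus_zero (x : M) : mmonus x 0 = x := m_monus_unique (add_zero x)

/-- If `P x` is inhabited by numbers bounded by `T` for the `x ≤ a`, induction for
`∃ z, P x z` up to `a` follows from minimization over the codes `(a - x) * 2 ^ |T| + z`. -/
theorem exists_of_minimal {P : M → M → Prop} {T a : M} (hT : ∀ x z, x ≤ a → P x z → z ≤ T)
    (h0 : ∃ z, P 0 z) (hs : ∀ x, (∃ z, P x z) → ∃ z, P (msucc x) z)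
    (hmin : ∀ w, mmsp w (mlen T) ≤ a ∧ P (mmonus a (mmsp w (mlen T)))
          (mmonus w (mmsp w (mlen T) * mpow T)) →
      ∃ c, (mmsp c (mlen T) ≤ a ∧ P (mmonus a (mmsp c (mlen T)))
          (mmonus c (mmsp c (mlen T) * mpow T))) ∧
        ∀ d, (mmsp d (mlen T) ≤ a ∧ P (mmonus a (mmsp d (mlen T)))
          (mmonus d (mmsp d (mlen T) * mpow T))) → ¬ d < c) : ∃ z, P a z := by
  have code {x q z : M} (hx : x + q = a) (hz : P x z) :
      z < mpow T ∧ mmsp (q * mpow T + z) (mlen T) ≤ a ∧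
        P (mmonus a (mmsp (q * mpow T + z) (mlen T)))
          (mmonus (q * mpow T + z) (mmsp (q * mpow T + z) (mlen T) * mpow T)) := by
    have hzT : z < mpow T := (hT x z (hx ▸ le_self_add) hz).trans_lt (m_lt_pow T)
    rw [m_msp_eq hzT, m_monus_unique hx, m_monus_unique (add_comm z _)]
    exact ⟨hzT, hx ▸ le_add_self, hz⟩
  obtain ⟨z₀, hz₀⟩ := h0
  obtain ⟨c, ⟨hc, hP⟩, hm⟩ := hmin _ (code (zero_add a) hz₀).2
  -- The quotient of the minimal code is `a - x`; if it is `0`, the code contains a witness for `a`.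
  by_cases hq : mmsp c (mlen T) = 0
  · rw [hq, m_monus_zero] at hP
    exact ⟨_, hP⟩
  · have hmul := m_msp_mul_le c T
    obtain ⟨q, hq⟩ := m_exists_succ hq
    rw [hq] at hP hc hmul
    obtain ⟨x, hx⟩ := m_exists_add hc
    rw [m_monus_unique hx.symm] at hP
    obtain ⟨z, hz⟩ := hs x ⟨_, hP⟩
    rw [msucc_eq] at hz
    have hx' : x + 1 + q = a := by rw [hx]; ring
    -- The induction step yields a witness for `x + 1`, whose code `q * 2 ^ |T| + z` lies below `(q
    -- + 1) * 2 ^ |T| ≤ c`.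
    refine absurd ?_ (hm _ (code hx' hz).2)
    refine lt_of_lt_of_le ?_ hmul
    rw [add_mul, one_mul]
    exact (add_lt_add_iff_left _).2 (code hx' hz).1

/-- If `P x` is inhabited by numbers bounded by `T` for the `x ≤ a`, polynomial induction for
`∃ z, P x z` up to `a` follows from length minimization over the codes `2 ^ (|T| + i) + z`, where
`x = ⌊a / 2 ^ i⌋`. -/
theorem exists_of_len_minimal {P : M → M → Prop} {T a : M} (hT : ∀ x z, x ≤ a → P x z → z ≤ T)
    (h0 : ∃ z, P 0 z) (hs : ∀ x, (∃ z, P (mhalf x) z) → ∃ z, P x z)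
    (hmin : ∀ w, mlen T + 1 ≤ mlen w ∧ P (mmsp a (mmonus (mlen w) (mlen T + 1)))
          (mmonus w (mpow (mhalf w))) →
      ∃ c, (mlen T + 1 ≤ mlen c ∧ P (mmsp a (mmonus (mlen c) (mlen T + 1)))
          (mmonus c (mpow (mhalf c)))) ∧
        ∀ d, (mlen T + 1 ≤ mlen d ∧ P (mmsp a (mmonus (mlen d) (mlen T + 1)))
          (mmonus d (mpow (mhalf d)))) → ¬ mlen d < mlen c) : ∃ z, P a z := by
  have code {i u z : M} (hu : mlen u = i + mlen T) (hz : P (mmsp a i) z) :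
      mlen (mpow u + z) = mlen u + 1 ∧ mlen T + 1 ≤ mlen (mpow u + z) ∧
        P (mmsp a (mmonus (mlen (mpow u + z)) (mlen T + 1)))
          (mmonus (mpow u + z) (mpow (mhalf (mpow u + z)))) := by
    have hzT : z < mpow u := (hT _ z (m_msp_le a i) hz).trans_lt
      ((m_lt_pow T).trans_le (m_pow_mono (hu ▸ le_add_self)))
    have hl : mlen (mpow u + z) = mlen u + 1 :=
      m_len_eq_of_pow le_self_add ((add_lt_add_iff_left _).2 hzT)
    have hne : mpow u + z ≠ 0 := fun h => (m_pow_pos u).ne' (m_add_eq_zero.1 h).1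
    have hp : mpow (mhalf (mpow u + z)) = mpow u :=
      m_pow_congr (add_right_cancel (b := (1 : M)) (by rw [← hl, m_len_half hne]))
    have hi : i + (mlen T + 1) = mlen u + 1 := by rw [hu]; ring
    rw [hp, hl, m_monus_unique hi, m_monus_unique (add_comm z _)]
    exact ⟨rfl, hi ▸ le_add_self, hz⟩
  obtain ⟨z₀, hz₀⟩ := h0
  -- The starting code needs a number of length `i + |T|` with `⌊a / 2 ^ i⌋ = 0`. The number `(a +
  -- T) # 3`, of length `2 |a + T| + 1`, is long enough.
  obtain ⟨i, hi⟩ : ∃ i, mlen (msmash (a + T) (1 + 1 + 1)) = i + mlen T ∧ mlen a ≤ i := by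
    rw [m_len_smash_three]
    obtain ⟨i, hi⟩ := m_exists_add (m_len_mono (le_add_self : T ≤ a + T))
    refine ⟨mlen (a + T) + i + 1, ?_, ?_⟩
    · rw [hi]; ring
    · rw [add_assoc]
      exact (m_len_mono (le_self_add : a ≤ a + T)).trans le_self_add
  rw [← m_msp_of_len_le hi.2] at hz₀
  obtain ⟨c, ⟨hc, hP⟩, hm⟩ := hmin _ (code hi.1 hz₀).2
  obtain ⟨j, hj⟩ := m_exists_add hc
  rw [m_monus_unique hj.symm] at hP
  by_cases hj0 : j = 0
  · rw [hj0, m_msp_zero] at hP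
    exact ⟨_, hP⟩
  · obtain ⟨j, rfl⟩ := m_exists_succ hj0
    rw [m_msp_succ] at hP
    obtain ⟨z, hz⟩ := hs _ ⟨_, hP⟩
    have hc0 : c ≠ 0 := by
      rw [Ne, ← m_len_eq_zero, hj]; simp
    have h1 : mlen (mhalf c) = j + mlen T + 1 := by
      refine add_right_cancel (b := (1 : M)) ?_
      rw [← m_len_half hc0, hj]; ring
    have hc1 : mhalf c ≠ 0 := by
      rw [Ne, ← m_len_eq_zero, h1]; simp
    have h2 : mlen (mhalf (mhalf c)) = j + mlen T := by
      refine add_right_cancel (b := (1 : M)) ?_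
      rw [← m_len_half hc1, h1]
    -- Passing from `⌊a / 2 ^ (j + 1)⌋` to `⌊a / 2 ^ j⌋` shortens the code by one bit. The number
    -- `⌊⌊c / 2⌋ / 2⌋` has the length `j + |T|` required for its leading power.
    refine absurd ?_ (hm _ (code h2 hz).2)
    rw [(code h2 hz).1, ← m_len_half hc1, m_len_half hc0]
    exact m_lt_add_one _

theorem piDef_codeF {n j : ℕ} {t : LTC.Term (Empty ⊕ Fin (n + 1))}
    {θ : LTC.BoundedFormula Empty (n + 2)} {l r x z : LTC.Term (Empty ⊕ Fin (n + 2))}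
    (h : PiDef j (n + 2) θ) : PiDef j (n + 2) (codeF t θ l r x z) :=
  (PiDef.bdLe _ _).inf ((PiDef.bdLe _ _).inf (h.substB _))

/-- A `Σ̂_{j+1}` formula contracts to `∃ z ≤ t θ` with `θ` in `Π̂ⱼ`. A monotone bound of `t` at `a`
bounds the witnesses for every `x ≤ a`, and the set of codes in `exists_of_minimal` is `Π̂ⱼ` by
`piDef_codeF`. -/
theorem HasMin.model_T2 {j : ℕ} (h : HasMin M j (· < ·)) : M ⊨ T2 (j + 1) := by
  refine ⟨?_⟩
  rintro _ ⟨n, φ, hφ, rfl⟩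
  rw [realize_indAxiom]
  intro y
  obtain ⟨t, θ, hθ, he⟩ := SigmaHat.exists_contraction
    ((hat_substVars (j + 1)).1 φ (Sum.elim (fun i => .var (.inr i)) Fin.elim0) hφ)
  obtain ⟨b, hb⟩ := exists_bound t
  have hφ' (x : M) := (realize_bindVars (v := Empty.elim) (φ := φ)
    (xs := (Fin.snoc y x : Fin (n + 1) → M))).symm.trans (he M _ _)
  simp only [hφ']
  intro h0 hs a
  refine exists_of_minimal
    (P := fun x z => z ≤ t.realize (Sum.elim Empty.elim (Fin.snoc y x : Fin (n + 1) → M)) ∧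
      θ.Realize Empty.elim (Fin.snoc (Fin.snoc y x : Fin (n + 1) → M) z))
    (T := b.realize (Sum.elim Empty.elim (Fin.snoc y a : Fin (n + 1) → M)))
    (fun x z hx hz => hz.1.trans (hb M _ _ (snoc_le_snoc hx))) h0 hs ?_
  let aT : LTC.Term (Empty ⊕ Fin (n + 2)) := .var (.inr (Fin.last n).castSucc)
  let bT := substLastT b (fun i => .var (.inr i.castSucc.castSucc)) aT
  let qT := msp (lastVar (n + 1)) (len bT)
  have := h (codeF t θ qT aT (monus aT qT) (monus (lastVar (n + 1)) (qT * powT bT)))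
    (piDef_codeF hθ) Empty.elim (Fin.snoc y a : Fin (n + 1) → M)
  simp only [realize_codeF, qT, bT, aT, realize_monus, realize_msp, realize_len, realize_lastVar,
    realize_mul, realize_powT, realize_substLastT, Term.realize_var, Sum.elim_inr,
    Fin.snoc_castSucc, Fin.snoc_last] at this
  exact this

/-- The same reduction with the codes of `exists_of_len_minimal`, whose lengths record the number of
halvings. -/
theorem HasMin.model_S2 {j : ℕ} (h : HasMin M j fun d c => mlen d < mlen c) : M ⊨ S2 (j + 1) := by
  refine ⟨?_⟩
  rintro _ ⟨n, φ, hφ, rfl⟩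
  rw [realize_pindAxiom]
  intro y
  obtain ⟨t, θ, hθ, he⟩ := SigmaHat.exists_contraction
    ((hat_substVars (j + 1)).1 φ (Sum.elim (fun i => .var (.inr i)) Fin.elim0) hφ)
  obtain ⟨b, hb⟩ := exists_bound t
  have hφ' (x : M) := (realize_bindVars (v := Empty.elim) (φ := φ)
    (xs := (Fin.snoc y x : Fin (n + 1) → M))).symm.trans (he M _ _)
  simp only [hφ']
  intro h0 hs a
  refine exists_of_len_minimal
    (P := fun x z => z ≤ t.realize (Sum.elim Empty.elim (Fin.snoc y x : Fin (n + 1) → M)) ∧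
      θ.Realize Empty.elim (Fin.snoc (Fin.snoc y x : Fin (n + 1) → M) z))
    (T := b.realize (Sum.elim Empty.elim (Fin.snoc y a : Fin (n + 1) → M)))
    (fun x z hx hz => hz.1.trans (hb M _ _ (snoc_le_snoc hx))) h0 hs ?_
  let aT : LTC.Term (Empty ⊕ Fin (n + 2)) := .var (.inr (Fin.last n).castSucc)
  let bT := substLastT b (fun i => .var (.inr i.castSucc.castSucc)) aT
  have := h (codeF t θ (len bT + S 0) (len (lastVar (n + 1)))
      (msp aT (monus (len (lastVar (n + 1))) (len bT + S 0)))
      (monus (lastVar (n + 1)) (powT (half (lastVar (n + 1))))))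
    (piDef_codeF hθ) Empty.elim (Fin.snoc y a : Fin (n + 1) → M)
  simp only [realize_codeF, bT, aT, realize_monus, realize_msp, realize_len, realize_lastVar,
    realize_add, realize_S, realize_zero, realize_half, msucc_eq, zero_add,
    realize_powT, realize_substLastT, Term.realize_var, Sum.elim_inr,
    Fin.snoc_castSucc, Fin.snoc_last] at this
  exact this

end Minimization

/-! ### Quantifier-free formulas -/

section QuantifierFree

open BoundedFormula

variable {α : Type}

theorem isQF_eqF (s t : LTC.Term α) : (eqF s t).IsQF := .of_isAtomic (.equal _ _)

theorem isQF_leF (s t : LTC.Term α) : (leF s t).IsQF := .of_isAtomic (.rel _ _)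

theorem isQF_iff {n : ℕ} {φ ψ : LTC.BoundedFormula α n} (hφ : φ.IsQF) (hψ : ψ.IsQF) :
    (φ ⇔ ψ).IsQF := (hφ.imp hψ).inf (hψ.imp hφ)

theorem isQF_ltF (s t : LTC.Term α) : (ltF s t).IsQF := (isQF_leF s t).inf (isQF_eqF s t).not

theorem isQF_initialAxiomsOf {x y z u : LTC.Term α} {φ : LTC.Formula α}
    (h : φ ∈ initialAxiomsOf x y z u) : φ.IsQF := by
  revert φ h
  simp only [initialAxiomsOf, List.forall_mem_cons]
  refine ⟨?_, ?_, ?_, ?_, ?_, ?_, ?_, ?_, ?_, ?_, ?_, ?_, ?_, ?_, ?_, ?_, ?_, ?_, ?_, ?_, ?_, ?_,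
    ?_, ?_, ?_, ?_, ?_, ?_, ?_, ?_, ?_, ?_, ?_, ?_, ?_, ?_, ?_, by simp⟩ <;>
  repeat' first
    | exact isQF_eqF _ _
    | exact isQF_leF _ _
    | exact isQF_bot
    | refine isQF_iff ?_ ?_
    | refine IsQF.imp ?_ ?_

theorem IsBaseAxiom.isQF {n : ℕ} {φ : LTC.Formula (Fin n)} (h : IsBaseAxiom φ) : φ.IsQF := by
  cases h with
  | initial h => exact isQF_initialAxiomsOf h
  | proj i => exact isQF_eqF _ _
  | comp f g => exact isQF_eqF _ _
  | bits_len f => exact isQF_leF _ _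
  | bits_bit f => exact (isQF_ltF _ _).imp (isQF_iff (isQF_eqF _ _) (isQF_eqF _ _).not)
  | least_le f => exact isQF_leF _ _
  | least_spec f => exact (isQF_ltF _ _).imp (isQF_eqF _ _).not
  | least_min f => exact (isQF_ltF _ _).imp (isQF_eqF _ _)

theorem realize_substructure {N : Type} [LTC.Structure N] (H : LTC.Substructure N) {n : ℕ}
    {φ : LTC.BoundedFormula α n} (hφ : φ.IsQF) (v : α → H) (xs : Fin n → H) :
    φ.Realize (fun a => (v a : N)) (fun i => (xs i : N)) ↔ φ.Realize v xs :=
  hφ.realize_embedding H.subtype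

theorem formula_realize_substructure {N : Type} [LTC.Structure N] (H : LTC.Substructure N)
    {φ : LTC.Formula α} (hφ : φ.IsQF) (v : α → H) :
    φ.Realize (fun a => (v a : N)) ↔ φ.Realize v := by
  rw [Formula.Realize, Formula.Realize, ← realize_substructure H hφ]
  exact iff_of_eq (congrArg _ (Subsingleton.elim _ _))

/-- The base theory is universal: its axioms are closures of quantifier-free formulas. -/
theorem substructure_model {N : Type} [LTC.Structure N] [N ⊨ baseTheory]
    (H : LTC.Substructure N) : H ⊨ baseTheory := by
  refine ⟨?_⟩
  rintro _ ⟨n, φ, hφ, rfl⟩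
  rw [realize_univClosure]
  exact fun v => (formula_realize_substructure H hφ.isQF v).1 (realize_of_isBaseAxiom hφ _)

end QuantifierFree

/-! ### Skolem constants with minimal values -/

/-- Closed terms over Skolem symbols for the formulas `θ (x₀, y₁, …, yₙ, z)` in `G`. -/
inductive Wit (G : ∀ n : ℕ, LTC.Formula (Fin (n + 2)) → Prop) : Type
  | mk (n : ℕ) (θ : LTC.Formula (Fin (n + 2))) (h : G n θ) (args : Fin n → Wit G) : Wit G

namespace Wit

variable {G : ∀ n : ℕ, LTC.Formula (Fin (n + 2)) → Prop}

def arity : Wit G → ℕ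
  | mk n _ _ _ => n

def form : (w : Wit G) → LTC.Formula (Fin (w.arity + 2))
  | mk _ θ _ _ => θ

def args : (w : Wit G) → Fin w.arity → Wit G
  | mk _ _ _ a => a

theorem good : (w : Wit G) → G w.arity w.form
  | mk _ _ h _ => h

end Wit

section Witness

/-- `φ (x₀) ∨ ∃ z θ (x₀, y, z)` holds in the models of `B + T`. -/
def IsTotal (T : LTC.Theory) (φ : LTC.Formula (Fin 1)) {n : ℕ}
    (θ : LTC.Formula (Fin (n + 2))) : Prop :=
  ∀ (N : Type) [LTC.Structure N] [N ⊨ baseTheory], N ⊨ T → ∀ v : Fin (n + 1) → N,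
    φ.Realize (fun _ => v 0) ∨ ∃ y, θ.Realize (Fin.snoc v y : Fin (n + 2) → N)

/-- The witnesses for total `Π̂ⱼ` formulas. -/
abbrev PiWit (T : LTC.Theory) (φ : LTC.Formula (Fin 1)) (j : ℕ) : Type :=
  Wit fun _ θ => IsPiHat j θ ∧ IsTotal T φ θ

/-- The values `v` of the witnesses satisfy their formulas and are `ρ`-minimal among all the
values of witnesses with this property. -/
def IsMinimalValuation {G : ∀ n : ℕ, LTC.Formula (Fin (n + 2)) → Prop} {N : Type}
    [LTC.Structure N] (ρ : LTC.Formula (Fin 2)) (x₀ : N) (v : Wit G → N) : Prop :=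
  ∀ w : Wit G, w.form.Realize (Fin.snoc (Fin.cons x₀ fun i => v (w.args i) : Fin (w.arity + 1) → N)
      (v w) : Fin (w.arity + 2) → N) ∧
    ∀ w' : Wit G, w.form.Realize (Fin.snoc (Fin.cons x₀ fun i => v (w.args i) :
      Fin (w.arity + 1) → N) (v w') : Fin (w.arity + 2) → N) → ¬ ρ.Realize ![v w', v w]

variable {T : LTC.Theory} {φ : LTC.Formula (Fin 1)} {j : ℕ} {ρ : LTC.Formula (Fin 2)}
  {N : Type} [LTC.Structure N] {x₀ : N} {v : PiWit T φ j → N} {α : Type}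

/-- All free variables identified with variable `0`, and bound variables turned into free ones. -/
def headVars {n : ℕ} (θ : LTC.BoundedFormula α n) : LTC.Formula (Fin (n + 1)) :=
  substVars θ (Sum.elim (fun _ => .var (.inl 0)) fun i => .var (.inl i.succ))

theorem realize_headVars {n : ℕ} {θ : LTC.BoundedFormula α n} {xs : Fin n → N} :
    (headVars θ).Realize (Fin.cons x₀ xs : Fin (n + 1) → N) ↔ θ.Realize (fun _ => x₀) xs := by
  rw [headVars, Formula.Realize, realize_substVars]
  simp only [Sum.elim_inl, Sum.elim_inr, Term.realize_var, Fin.cons_zero, Fin.cons_succ]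

/-- `φ (x₀) ∨ ψ (x₀, xs)` holds in the models of `B + T`. -/
def HoldsOr (T : LTC.Theory) (φ : LTC.Formula (Fin 1)) {n : ℕ}
    (ψ : LTC.BoundedFormula α n) : Prop :=
  ∀ (N : Type) [LTC.Structure N] [N ⊨ baseTheory], N ⊨ T → ∀ (x₀ : N) (xs : Fin n → N),
    φ.Realize (fun _ => x₀) ∨ ψ.Realize (fun _ => x₀) xs

theorem coe_snoc {H : LTC.Substructure N} {n : ℕ} (xs : Fin n → H) (z : H) :
    (fun i => ((Fin.snoc xs z : Fin (n + 1) → H) i : N)) =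
      (Fin.snoc (fun i => (xs i : N)) (z : N) : Fin (n + 1) → N) := by
  funext i
  refine Fin.lastCases ?_ (fun i => ?_) i <;> simp

variable [N ⊨ baseTheory]

/-- After replacing `Θ` by an equivalent strict `Π̂ⱼ` formula and renaming variables, it is itself
the formula of a name with arguments `ys`, so the definition of a minimal valuation applies to that
name. -/
theorem IsMinimalValuation.exists_wit (hv : IsMinimalValuation ρ x₀ v) {n : ℕ}
    {Θ : LTC.BoundedFormula α (n + 1)} (hΘ : PiDef j (n + 1) Θ) (htot : HoldsOr T φ Θ.ex)
    (ys : Fin n → PiWit T φ j) : ∃ w, Θ.Realize (fun _ => x₀) (Fin.snoc (fun i => v (ys i)) (v w)) ∧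
      ∀ w', Θ.Realize (fun _ => x₀) (Fin.snoc (fun i => v (ys i)) (v w')) →
        ¬ ρ.Realize ![v w', v w] := by
  obtain ⟨θ, hθ, he⟩ := hΘ
  have hG : IsPiHat j (headVars θ) ∧ IsTotal T φ (headVars θ) := by
    refine ⟨(hat_substVars j).2 _ _ hθ, fun N _ _ hN u => ?_⟩
    rw [← Fin.cons_self_tail u]
    refine (htot N hN (u 0) (Fin.tail u)).imp id fun h => ?_
    obtain ⟨y, hy⟩ := BoundedFormula.realize_ex.1 h
    refine ⟨y, ?_⟩
    rw [← Fin.cons_snoc_eq_snoc_cons, realize_headVars, ← he]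
    exact hy
  have h := hv (Wit.mk n (headVars θ) hG ys)
  simp only [Wit.form, Wit.args, Wit.arity, ← Fin.cons_snoc_eq_snoc_cons, realize_headVars,
    ← he N] at h
  exact ⟨_, h⟩

/-- The values of the witnesses form a substructure. -/
def IsMinimalValuation.substructure (hv : IsMinimalValuation ρ x₀ v) : LTC.Substructure N where
  carrier := Set.range v
  fun_mem := by
    intro n f xs hxs
    choose ys hys using hxs
    -- The formula `z = f (y)` is total, so the value of `f` is the value of a name.
    obtain ⟨w, hw, -⟩ := hv.exists_wit (α := Empty) (n := n)
      (Θ := (lastVar n).bdEqual (fn f (initVars n))) (PiDef.bdEqual _ _)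
      (fun N _ _ _ x₀ xs => .inr (BoundedFormula.realize_ex.2
        ⟨app f xs, by simp [BoundedFormula.realize_bdEqual]⟩)) ys
    refine ⟨w, ?_⟩
    simpa [BoundedFormula.realize_bdEqual, hys] using hw

/-- Elements of the substructure are values of names; choosing names for the parameters turns
minimality among names into minimality within the substructure. -/
theorem IsMinimalValuation.exists_mem (hv : IsMinimalValuation ρ x₀ v) {n : ℕ}
    {Θ : LTC.BoundedFormula α (n + 1)} (hΘ : PiDef j (n + 1) Θ) (htot : HoldsOr T φ Θ.ex)
    (xs : Fin n → hv.substructure) : ∃ c : hv.substructure,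
      Θ.Realize (fun _ => x₀) (Fin.snoc (fun i => (xs i : N)) (c : N)) ∧
      ∀ d : hv.substructure, Θ.Realize (fun _ => x₀) (Fin.snoc (fun i => (xs i : N)) (d : N)) →
        ¬ ρ.Realize ![(d : N), (c : N)] := by
  have h (d : hv.substructure) : ∃ w, v w = (d : N) := d.2
  choose g hg using h
  obtain ⟨w, hw, hm⟩ := hv.exists_wit hΘ htot fun i => g (xs i)
  simp only [hg] at hw hm
  refine ⟨⟨v w, w, rfl⟩, hw, fun d => ?_⟩
  rw [← hg d]
  exact hm (g d)

theorem IsMinimalValuation.mem (hv : IsMinimalValuation ρ x₀ v) : x₀ ∈ hv.substructure := by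
  obtain ⟨c, hc, -⟩ := hv.exists_mem (α := Unit) (n := 0)
    (Θ := (lastVar 0).bdEqual (.var (.inl ()))) (PiDef.bdEqual _ _)
    (fun N _ _ _ x₀ xs => .inr (BoundedFormula.realize_ex.2
      ⟨x₀, by simp [BoundedFormula.realize_bdEqual]⟩)) (fun i => i.elim0)
  have h : (c : N) = x₀ := by simpa [BoundedFormula.realize_bdEqual] using hc
  obtain ⟨w, hw⟩ := c.2
  exact ⟨w, hw.trans h⟩

/-- The first parameter as an element of the substructure. -/
def IsMinimalValuation.base (hv : IsMinimalValuation ρ x₀ v) : hv.substructure := ⟨x₀, hv.mem⟩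

/-- The truth value of `ψ` is the same in the substructure and in the structure. -/
def IsMinimalValuation.Absolute (hv : IsMinimalValuation ρ x₀ v) {n : ℕ}
    (ψ : LTC.BoundedFormula α n) : Prop :=
  ∀ xs : Fin n → hv.substructure, ψ.Realize (fun _ => hv.base) xs ↔
    ψ.Realize (fun _ => x₀) fun i => (xs i : N)

theorem IsMinimalValuation.absolute_of_isQF (hv : IsMinimalValuation ρ x₀ v) {n : ℕ}
    {ψ : LTC.BoundedFormula α n} (h : ψ.IsQF) : hv.Absolute ψ :=
  fun xs => (realize_substructure hv.substructure h (fun _ => hv.base) xs).symm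

theorem IsMinimalValuation.Absolute.imp {hv : IsMinimalValuation ρ x₀ v} {n : ℕ}
    {ψ χ : LTC.BoundedFormula α n} (hψ : hv.Absolute ψ) (hχ : hv.Absolute χ) :
    hv.Absolute (ψ ⟹ χ) := fun xs => by
  simp only [BoundedFormula.realize_imp, hψ xs, hχ xs]

theorem IsMinimalValuation.Absolute.not {hv : IsMinimalValuation ρ x₀ v} {n : ℕ}
    {ψ : LTC.BoundedFormula α n} (hψ : hv.Absolute ψ) : hv.Absolute (∼ψ) := fun xs => by
  simp only [BoundedFormula.realize_not, hψ xs]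

theorem IsMinimalValuation.Absolute.inf {hv : IsMinimalValuation ρ x₀ v} {n : ℕ}
    {ψ χ : LTC.BoundedFormula α n} (hψ : hv.Absolute ψ) (hχ : hv.Absolute χ) :
    hv.Absolute (ψ ⊓ χ) := fun xs => by
  simp only [BoundedFormula.realize_inf, hψ xs, hχ xs]

/-- Absoluteness of an existential formula whose Skolem formula is `Π̂ⱼ`. -/
theorem IsMinimalValuation.Absolute.ex {hv : IsMinimalValuation ρ x₀ v} {n : ℕ}
    {χ : LTC.BoundedFormula α (n + 1)} (hχ : hv.Absolute χ)
    (hs : PiDef j (n + 1) (weaken χ.ex ⟹ χ)) : hv.Absolute χ.ex := by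
  intro xs
  simp only [BoundedFormula.realize_ex]
  constructor
  · rintro ⟨z, hz⟩
    rw [hχ, coe_snoc] at hz
    exact ⟨z, hz⟩
  · intro h
    -- The Skolem formula `∃ z χ → χ (z)` is total by logic alone, and its witness lies in the
    -- substructure.
    obtain ⟨c, hc, -⟩ := hv.exists_mem hs (fun N _ _ _ x₀ xs => .inr (by
      simp only [BoundedFormula.realize_ex, BoundedFormula.realize_imp, realize_weaken]
      by_cases h : ∃ z, χ.Realize (fun _ => x₀) (Fin.snoc xs z)
      · obtain ⟨z, hz⟩ := h
        exact ⟨z, fun _ => hz⟩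
      · exact ⟨x₀, fun h' => absurd h' h⟩)) xs
    simp only [BoundedFormula.realize_imp, realize_weaken, BoundedFormula.realize_ex] at hc
    refine ⟨c, ?_⟩
    rw [hχ, coe_snoc]
    exact hc h

theorem IsMinimalValuation.Absolute.congr {hv : IsMinimalValuation ρ x₀ v} {n : ℕ}
    {ψ χ : LTC.BoundedFormula α n} (hχ : hv.Absolute χ) (h : BEquiv ψ χ) : hv.Absolute ψ :=
  fun xs => by
    have := substructure_model hv.substructure
    rw [h, h N, hχ xs]

theorem IsMinimalValuation.absolute_lastLe (hv : IsMinimalValuation ρ x₀ v) {n : ℕ}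
    (t : LTC.Term (α ⊕ Fin n)) : hv.Absolute (lastLe t) :=
  hv.absolute_of_isQF (.of_isAtomic (.rel _ _))

/-- The Skolem formula of a sharply bounded existential formula is again sharply bounded, hence
`Π̂ⱼ` for every `j`, including `j = 0`. -/
theorem IsMinimalValuation.absolute_of_isSharplyBounded (hv : IsMinimalValuation ρ x₀ v) {n : ℕ}
    {ψ : LTC.BoundedFormula α n} (h : IsSharplyBounded ψ) : hv.Absolute ψ := by
  have hex {n : ℕ} (t : LTC.Term (α ⊕ Fin n)) {ψ : LTC.BoundedFormula α (n + 1)}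
      (h : IsSharplyBounded ψ) (hψ : hv.Absolute ψ) : hv.Absolute (bdEx (len t) ψ) :=
    ((hv.absolute_lastLe _).inf hψ).ex (.of_isSharplyBounded (.imp
      (IsSharplyBounded.substVars (.ex t h) _) (.inf (isSharplyBounded_bdLe _ _) h)))
  induction h with
  | falsum => exact fun xs => Iff.rfl
  | atomic h => exact hv.absolute_of_isQF (.of_isAtomic h)
  | imp _ _ ih₁ ih₂ => exact ih₁.imp ih₂
  | all t h ih =>
    refine (hex t h.not ih.not).not.congr fun M _ _ v xs => ?_
    simp only [realize_bdAll, BoundedFormula.realize_not, realize_bdEx, not_exists, not_and,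
      not_not]
  | ex t h ih => exact hex t h ih

theorem PiDef.mono {n i : ℕ} {ψ : LTC.BoundedFormula α n} (h : PiDef i n ψ) (hij : i ≤ j) :
    PiDef j n ψ := by
  induction hij with
  | refl => exact h
  | step _ ih => exact ih.succ

/-- The negation of a `Π̂_{i+1}` formula contracts to a single `∃ z ≤ t θ` with `θ` in `Π̂ᵢ`. Its
Skolem formula is a disjunction of a negated `Σ̂_{i+1}` formula and a `Π̂ᵢ` one, hence `Π̂_{i+1}`,
which is admissible while `i + 1 ≤ j`. -/
theorem IsMinimalValuation.absolute (hv : IsMinimalValuation ρ x₀ v) {i : ℕ} (hi : i ≤ j) {n : ℕ}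
    {ψ : LTC.BoundedFormula α n} (h : PiDef i n ψ) : hv.Absolute ψ := by
  induction i generalizing n with
  | zero =>
    obtain ⟨χ, hχ, he⟩ := h
    exact (hv.absolute_of_isSharplyBounded hχ).congr he
  | succ i ih =>
    obtain ⟨χ, hχ, he⟩ := h.not
    obtain ⟨t, θ, hθ, he'⟩ := SigmaHat.exists_contraction hχ
    have hsig : SigmaDef (i + 1) n (bdEx t θ) := by
      obtain ⟨θ', hθ', h'⟩ := hθ
      refine ⟨bdEx t θ', .ex t (.base hθ'), fun M _ _ v xs => ?_⟩
      simp only [realize_bdEx, h' M]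
    have hwk : SigmaDef (i + 1) (n + 1) (weaken (bdEx t θ)) := by
      obtain ⟨δ, hδ, h'⟩ := hsig
      refine ⟨weaken δ, (hat_substVars (i + 1)).1 _ _ hδ, fun M _ _ v xs => ?_⟩
      simp only [weaken, realize_substB, h' M]
    have hex : hv.Absolute (bdEx t θ) :=
      ((hv.absolute_lastLe t).inf (ih (by omega) hθ)).ex
        (((hwk.not.sup ((PiDef.bdLe _ _).inf hθ).succ).mono hi).congr fun M _ _ v xs => by
          rw [BoundedFormula.realize_imp, BoundedFormula.realize_sup, BoundedFormula.realize_not,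
            imp_iff_not_or]; rfl)
    refine hex.not.congr fun M _ _ v xs => ?_
    have h1 := he M v xs
    rw [he' M] at h1
    simp only [BoundedFormula.realize_not, realize_bdEx] at h1 ⊢
    rw [← h1, not_not]

theorem IsMinimalValuation.hasMin (hv : IsMinimalValuation ρ x₀ v) (hρ : ρ.IsQF) :
    HasMin hv.substructure j fun d c => ρ.Realize ![d, c] := by
  intro m Θ hΘ u xs w hw
  -- `Θ (z) ∨ z = w` is total, with `z = w`. Since `w` satisfies `Θ`, the disjunct `z = w` adds no
  -- new solution, and the minimal witness of `Θ'` is minimal for `Θ`.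
  let Θ' : LTC.BoundedFormula Empty (m + 2) :=
    substB Θ (Fin.snoc (fun i => .var (.inr i.castSucc.castSucc)) (lastVar _)) ⊔
      (lastVar (m + 1)).bdEqual (.var (.inr (Fin.last m).castSucc))
  have hΘ' {N' : Type} [LTC.Structure N'] (u : Empty → N') (ys : Fin m → N') (y z : N') :
      Θ'.Realize u (Fin.snoc (Fin.snoc ys y : Fin (m + 1) → N') z) ↔
        Θ.Realize u (Fin.snoc ys z) ∨ z = y := by
    simp only [Θ', BoundedFormula.realize_sup, realize_substB, realize_snoc,
      BoundedFormula.realize_bdEqual, realize_lastVar, Term.realize_var, Sum.elim_inr,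
      Fin.snoc_castSucc, Fin.snoc_last]
  have habs := hv.absolute le_rfl hΘ
  have hcoe (z : hv.substructure) : Θ.Realize u (Fin.snoc xs z) ↔
      Θ.Realize (fun _ => x₀) (Fin.snoc (fun i => (xs i : N)) (z : N)) := by
    rw [← coe_snoc, ← habs, Subsingleton.elim u]
  obtain ⟨c, hc, hm⟩ := hv.exists_mem (Θ := Θ') ((hΘ.substB _).sup (PiDef.bdEqual _ _))
    (fun N _ _ _ x₀ zs => .inr (by
      rw [BoundedFormula.realize_ex]
      refine ⟨zs (Fin.last m), ?_⟩
      rw [← Fin.snoc_init_self zs, hΘ']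
      simp)) (Fin.snoc xs w : Fin (m + 1) → hv.substructure)
  rw [coe_snoc] at hc hm
  simp only [hΘ'] at hc hm
  refine ⟨c, (hcoe c).2 (hc.elim id fun h => ?_), fun d hd h => ?_⟩
  · rw [h]; exact (hcoe w).1 hw
  · refine hm d (.inl ((hcoe d).1 hd)) ?_
    have h' := (formula_realize_substructure hv.substructure hρ ![d, c]).2 h
    convert h' using 1
    funext i; fin_cases i <;> rfl

/-- Universal quantifiers simply restrict to the substructure. The `∃Σ̂_{j+1}` matrix contracts to
`∃ z θ` with `θ` total and `Π̂ⱼ`, so a witness is present and absoluteness applies. Permitting the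
alternative `φ (x₀)` lets this serve for `¬φ` as well as for the axioms of `T`. -/
theorem IsMinimalValuation.realize_of_allEx (hv : IsMinimalValuation ρ x₀ v) {n : ℕ}
    {ψ : LTC.BoundedFormula α n} (h : AllBlock (ExBlock (SigmaHat (j + 1))) n ψ)
    (htot : HoldsOr T φ ψ) (xs : Fin n → hv.substructure) :
    ψ.Realize (fun _ => hv.base) xs := by
  induction h with
  | base h =>
    have := substructure_model hv.substructure
    obtain ⟨θ, hθ, he⟩ := h.exists_contraction
    obtain ⟨c, hc, -⟩ := hv.exists_mem hθ (fun N _ _ hN x₀ xs => (htot N hN x₀ xs).imp id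
      fun h => BoundedFormula.realize_ex.2 ((he N _ _).1 h)) xs
    rw [he]
    refine ⟨c, ?_⟩
    rwa [hv.absolute le_rfl hθ, coe_snoc]
  | all _ ih =>
    intro z
    refine ih (fun N _ _ hN x₀ xs => ?_) _
    refine (htot N hN x₀ (Fin.init xs)).imp id fun h => ?_
    have := BoundedFormula.realize_all.1 h (xs (Fin.last _))
    rwa [Fin.snoc_init_self] at this

end Witness

/-! ### Finite chains of witnesses -/

section Chains

variable {G : ∀ n : ℕ, LTC.Formula (Fin (n + 2)) → Prop}

/-- A list of witnesses in which the arguments of each witness precede it. -/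
def IsChain (L : List (Wit G)) : Prop :=
  ∀ (p : ℕ) (hp : p < L.length) (i : Fin L[p].arity), L[p].args i ∈ L.take p

theorem IsChain.concat {L : List (Wit G)} (hL : IsChain L) {w : Wit G}
    (hw : ∀ i, w.args i ∈ L) : IsChain (L ++ [w]) := by
  intro p hp
  rcases Nat.lt_or_ge p L.length with h | h
  · rw [List.getElem_append_left h, List.take_append_of_le_length h.le]
    exact hL p h
  · have hp' : p = L.length := by simp at hp; omega
    subst hp'
    have key : (L ++ [w])[L.length] = w := by simp
    rw [key, List.take_left]
    exact hw

/-- Induction on the name: its finitely many arguments are adjoined before the name itself.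
Repetitions in the list are harmless. -/
theorem IsChain.exists_superset (w : Wit G) : ∀ {L : List (Wit G)}, IsChain L →
    ∃ L', IsChain L' ∧ L ⊆ L' ∧ w ∈ L' := by
  induction w with
  | mk n θ h args ih =>
    intro L hL
    have key (s : Finset (Fin n)) : ∃ L', IsChain L' ∧ L ⊆ L' ∧ ∀ i ∈ s, args i ∈ L' := by
      classical
      induction s using Finset.induction_on with
      | empty => exact ⟨L, hL, fun _ h => h, by simp⟩
      | insert i s _ ihs =>
        obtain ⟨L₁, h₁, hs₁, ha₁⟩ := ihs
        obtain ⟨L₂, h₂, hs₂, ha₂⟩ := ih i h₁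
        refine ⟨L₂, h₂, fun _ h => hs₂ (hs₁ h), fun k hk => ?_⟩
        rcases Finset.mem_insert.1 hk with rfl | hk
        · exact ha₂
        · exact hs₂ (ha₁ k hk)
    obtain ⟨L', h', hs', ha'⟩ := key Finset.univ
    exact ⟨L' ++ [Wit.mk n θ h args], h'.concat fun i => ha' i (Finset.mem_univ _),
      fun _ h => List.mem_append_left _ (hs' h), by simp⟩

/-- The variables of `w.form`, for the value of `w` given by `z`: the parameter is `none` and the
value of a witness `w` is `some w`. -/
def witVars (w z : Wit G) : Fin (w.arity + 2) → Option (Wit G) :=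
  Fin.snoc (Fin.cons none fun i => some (w.args i) : Fin (w.arity + 1) → Option (Wit G)) (some z)

theorem comp_witVars {N : Type} (u : Option (Wit G) → N) (w z : Wit G) :
    u ∘ witVars w z = (Fin.snoc (Fin.cons (u none) fun i => u (some (w.args i)) :
      Fin (w.arity + 1) → N) (u (some z)) : Fin (w.arity + 2) → N) := by
  rw [witVars, Fin.comp_snoc, Fin.comp_cons]
  rfl

/-- The formulas saying that the values of the witnesses in `A` form a minimal valuation for a
counterexample to `φ`. -/
def valuationAxioms (ρ : LTC.Formula (Fin 2)) (φ : LTC.Formula (Fin 1)) (A : Set (Wit G)) :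
    Set (LTC.Formula (Option (Wit G))) :=
  {∼(φ.relabel fun _ => none)} ∪ {δ | ∃ w ∈ A, δ = w.form.relabel (witVars w w)} ∪
    {δ | ∃ w ∈ A, ∃ z ∈ A,
      δ = ∼(ρ.relabel ![some z, some w] ⊓ w.form.relabel (witVars w z))}

theorem valuationAxioms_mono {ρ : LTC.Formula (Fin 2)} {φ : LTC.Formula (Fin 1)}
    {A B : Set (Wit G)} (h : A ⊆ B) : valuationAxioms ρ φ A ⊆ valuationAxioms ρ φ B := by
  rintro δ ((hδ | ⟨w, hw, hδ⟩) | ⟨w, hw, z, hz, hδ⟩)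
  · exact .inl (.inl hδ)
  · exact .inl (.inr ⟨w, h hw, hδ⟩)
  · exact .inr ⟨w, h hw, z, h hz, hδ⟩

/-- Each condition mentions at most two names, so finitely many conditions fit in one chain. -/
theorem exists_chain_of_finset {ρ : LTC.Formula (Fin 2)} {φ : LTC.Formula (Fin 1)}
    (Δ : Finset (LTC.Formula (Option (Wit G))))
    (hΔ : (Δ : Set (LTC.Formula (Option (Wit G)))) ⊆ valuationAxioms ρ φ Set.univ) :
    ∃ L : List (Wit G), IsChain L ∧
      (Δ : Set (LTC.Formula (Option (Wit G)))) ⊆ valuationAxioms ρ φ {w | w ∈ L} := by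
  classical
  induction Δ using Finset.induction_on with
  | empty => exact ⟨[], fun p hp => absurd hp (by simp), by simp⟩
  | insert δ Δ _ ih =>
    rw [Finset.coe_insert, Set.insert_subset_iff] at hΔ
    obtain ⟨L, hL, hs⟩ := ih hΔ.2
    rcases hΔ.1 with (hδ | ⟨w, -, hδ⟩) | ⟨w, -, z, -, hδ⟩
    · refine ⟨L, hL, ?_⟩
      rw [Finset.coe_insert, Set.insert_subset_iff]
      exact ⟨.inl (.inl hδ), hs⟩
    · obtain ⟨L₁, h₁, hs₁, hw₁⟩ := hL.exists_superset w
      refine ⟨L₁, h₁, ?_⟩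
      rw [Finset.coe_insert, Set.insert_subset_iff]
      exact ⟨.inl (.inr ⟨w, hw₁, hδ⟩), hs.trans (valuationAxioms_mono fun _ h => hs₁ h)⟩
    · obtain ⟨L₁, h₁, hs₁, hw₁⟩ := hL.exists_superset w
      obtain ⟨L₂, h₂, hs₂, hz₂⟩ := h₁.exists_superset z
      refine ⟨L₂, h₂, ?_⟩
      rw [Finset.coe_insert, Set.insert_subset_iff]
      exact ⟨.inr ⟨w, hs₂ hw₁, z, hz₂, hδ⟩,
        hs.trans (valuationAxioms_mono fun _ h => hs₂ (hs₁ h))⟩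

end Chains

/-! ### The witnessing theorem -/

section Main

theorem isMinimalValuation_of_realize {G : ∀ n : ℕ, LTC.Formula (Fin (n + 2)) → Prop}
    {ρ : LTC.Formula (Fin 2)} {φ : LTC.Formula (Fin 1)} {N : Type} [LTC.Structure N]
    {u : Option (Wit G) → N} (h : ∀ δ ∈ valuationAxioms ρ φ Set.univ, δ.Realize u) :
    ¬ φ.Realize (fun _ => u none) ∧ IsMinimalValuation ρ (u none) fun w => u (some w) := by
  constructor
  · have := h _ (.inl (.inl rfl))
    rw [Formula.realize_not, Formula.realize_relabel] at this
    exact this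
  · refine fun w => ⟨?_, fun z hz hρ => ?_⟩
    · have := h _ (.inl (.inr ⟨w, trivial, rfl⟩))
      rwa [Formula.realize_relabel, comp_witVars] at this
    · have := h _ (.inr ⟨w, trivial, z, trivial, rfl⟩)
      rw [Formula.realize_not, Formula.realize_inf, Formula.realize_relabel,
        Formula.realize_relabel, comp_witVars] at this
      refine this ⟨?_, hz⟩
      convert hρ using 1
      funext i; fin_cases i <;> rfl

/-- If `φ` holds in all models of `B + Γ` with `Π̂ⱼ` minimization, it holds at the parameter of every
minimal valuation. -/
theorem IsMinimalValuation.realize {T Γ : LTC.Theory} {φ : LTC.Formula (Fin 1)} {j : ℕ}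
    {ρ : LTC.Formula (Fin 2)} (hρ : ρ.IsQF) (hΓ : ∀ σ ∈ Γ, IsAllExSigmaHat (j + 1) σ)
    (hTΓ : ∀ σ ∈ Γ, Proves T σ) (hφ : IsExAllPiHat (j + 1) φ)
    (hprov : ∀ (M : Type) [LTC.Structure M] [Nonempty M], M ⊨ baseTheory → M ⊨ Γ →
      HasMin M j (fun d c => ρ.Realize ![d, c]) → ∀ x : M, φ.Realize fun _ => x)
    {N : Type} [LTC.Structure N] [N ⊨ baseTheory] {x₀ : N} {v : PiWit T φ j → N}
    (hv : IsMinimalValuation ρ x₀ v) : φ.Realize fun _ => x₀ := by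
  have hB := substructure_model hv.substructure
  have : Nonempty hv.substructure := ⟨hv.base⟩
  have hΓ' : hv.substructure ⊨ Γ := by
    refine ⟨fun σ hσ => ?_⟩
    have := hv.realize_of_allEx (hΓ σ hσ) (fun M _ hM hT x₀ xs => .inr ?_) default
    · rw [Sentence.Realize, Formula.Realize, Subsingleton.elim default (fun _ => hv.base)]
      exact this
    · have : Nonempty M := ⟨x₀⟩
      have h := (hTΓ σ hσ).realize M hM hT
      rw [Sentence.Realize, Formula.Realize, Subsingleton.elim default (fun _ => x₀),
        Subsingleton.elim default xs] at h
      exact h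
  have hval := hprov _ hB hΓ' (hv.hasMin hρ) hv.base
  obtain ⟨ψ, hψ, he⟩ := ExBlock.exists_not hφ
  by_contra hcon
  -- `φ ∨ ¬φ` is valid, so the `∀∃Σ̂_{j+1}` form of `¬φ` transfers to the substructure, where `φ`
  -- has just been shown to hold.
  have h := hv.realize_of_allEx hψ (fun M _ _ _ x₀ xs => by
    rw [← he M, BoundedFormula.realize_not, Subsingleton.elim xs default]
    exact em _) default
  rw [← he] at h
  exact h hval

open Classical in
/-- The position in a chain of the argument `i` of the witness at position `p`, shifted by one. -/
noncomputable def argPos {G : ∀ n : ℕ, LTC.Formula (Fin (n + 2)) → Prop} {L : List (Wit G)}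
    (hL : IsChain L) (p : Fin L.length) (i : Fin L[p].arity) : Fin (p.val + 1) :=
  ⟨L.idxOf (L[p].args i) + 1, Nat.succ_lt_succ ((List.mem_take_iff_idxOf_lt
    (List.mem_of_mem_take (hL p p.2 i))).1 (hL p p.2 i))⟩

/-- The variables `x₀, …, x_{p+1}` substituted for those of the formula of the witness at
position `p`. -/
noncomputable def chainVars {G : ∀ n : ℕ, LTC.Formula (Fin (n + 2)) → Prop} {L : List (Wit G)}
    (hL : IsChain L) (p : Fin L.length) : Fin (L[p].arity + 1) → Fin (p.val + 1) :=
  Fin.cons 0 (argPos hL p)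

/-- The formula `θ (x₀, …, x_{p+1})` of the witness at position `p` of a chain. -/
noncomputable def chainForm {G : ∀ n : ℕ, LTC.Formula (Fin (n + 2)) → Prop} {L : List (Wit G)}
    (hL : IsChain L) (p : Fin L.length) : LTC.Formula (Fin (p.val + 2)) :=
  substVars L[p].form (Sum.elim (fun a => .var (.inl ((Fin.snoc
    (fun i => (chainVars hL p i).castSucc) (Fin.last _) :
      Fin (L[p].arity + 2) → Fin (p.val + 2)) a))) Fin.elim0)

theorem realize_chainForm {G : ∀ n : ℕ, LTC.Formula (Fin (n + 2)) → Prop} {L : List (Wit G)}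
    (hL : IsChain L) (p : Fin L.length) {N : Type} [LTC.Structure N] (x : Fin (p.val + 1) → N)
    (y : N) : (chainForm hL p).Realize (Fin.snoc x y : Fin (p.val + 2) → N) ↔
      L[p].form.Realize (Fin.snoc (fun i => x (chainVars hL p i)) y :
        Fin (L[p].arity + 2) → N) := by
  rw [chainForm, Formula.Realize, realize_substVars, Formula.Realize]
  have h : (fun a => (Sum.elim (fun a => .var (.inl ((Fin.snoc
      (fun i => (chainVars hL p i).castSucc) (Fin.last _) :
        Fin (L[p].arity + 2) → Fin (p.val + 2)) a))) Fin.elim0 (.inl a) :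
          LTC.Term (Fin (p.val + 2) ⊕ Fin 0)).realize
            (Sum.elim (Fin.snoc x y : Fin (p.val + 2) → N) default)) =
      (Fin.snoc (fun i => x (chainVars hL p i)) y : Fin (L[p].arity + 2) → N) := by
    funext a
    refine Fin.lastCases ?_ (fun a => ?_) a <;> simp
  rw [h]
  exact iff_of_eq (congrArg _ (Subsingleton.elim _ _))

/-- Both cases of the theorem at once, with `ρ` defining `≺`. The formulas `θ` belong to the names
in a finite chain that supports an inconsistent set of valuation conditions. -/
theorem witnessing {T Γ : LTC.Theory} {φ : LTC.Formula (Fin 1)} {j : ℕ}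
    {ρ : LTC.Formula (Fin 2)} (hρ : ρ.IsQF) (hΓ : ∀ σ ∈ Γ, IsAllExSigmaHat (j + 1) σ)
    (hTΓ : ∀ σ ∈ Γ, Proves T σ) (hφ : IsExAllPiHat (j + 1) φ)
    (hprov : ∀ (M : Type) [LTC.Structure M] [Nonempty M], M ⊨ baseTheory → M ⊨ Γ →
      HasMin M j (fun d c => ρ.Realize ![d, c]) → ∀ x : M, φ.Realize fun _ => x)
    (prec : ∀ k : ℕ, LTC.Term (Fin k) → LTC.Term (Fin k) → LTC.Formula (Fin k))
    (hprec : ∀ (k : ℕ) (s t : LTC.Term (Fin k)) (N : Type) [LTC.Structure N] (v : Fin k → N),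
      (prec k s t).Realize v ↔ ρ.Realize ![s.realize v, t.realize v]) :
    ∃ (k : ℕ) (θ : ∀ i : Fin k, LTC.Formula (Fin (i.val + 2))),
      (∀ i, IsPiHat j (θ i)) ∧ (∀ i, Proves T (univClosure (totalF φ (θ i)))) ∧
      Proves T (univClosure (descentF (prec (k + 1)) φ θ)) := by
  classical
  obtain ⟨Δ, hΔ, hfin⟩ := exists_finset_of_not_realize (baseTheory ∪ T)
    (valuationAxioms (G := fun _ θ => IsPiHat j θ ∧ IsTotal T φ θ) ρ φ Set.univ) (by
      intro N _ _ u hN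
      have := (Theory.model_union_iff.1 hN).1
      by_contra! hcon
      obtain ⟨h₁, h₂⟩ := isMinimalValuation_of_realize hcon
      exact h₁ (h₂.realize hρ hΓ hTΓ hφ hprov))
  obtain ⟨L, hL, hΔL⟩ := exists_chain_of_finset Δ hΔ
  refine ⟨L.length, chainForm hL, fun p => (hat_substVars j).2 _ _ L[p].good.1, fun p => ?_, ?_⟩
  · rw [proves_iff]
    intro N _ _ hB hT
    rw [realize_univClosure]
    intro x
    rw [totalF, Formula.realize_sup, Formula.realize_relabel, realize_exLast]
    simp only [realize_chainForm]
    exact L[p].good.2 N hT fun i => x (chainVars hL p i)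
  · rw [proves_iff]
    intro N _ _ hB hT
    rw [realize_univClosure]
    intro x
    rw [descentF, Formula.realize_imp, Formula.realize_iInf, Formula.realize_sup,
      Formula.realize_iSup, Formula.realize_relabel]
    intro hθ
    simp only [Formula.realize_iSup, Formula.realize_inf, hprec, Term.realize_var]
    by_contra! hcon
    obtain ⟨hnφ, hdesc⟩ := hcon
    -- A counterexample to the descent formula assigns values to the names in `L`: the name at
    -- position `p` receives `x_{p+1}`, since `x₀` is the parameter. For repeated names the first
    -- position counts; the default outside `L` plays no role.
    let u : Option (PiWit T φ j) → N := fun o => o.elim (x 0) fun w =>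
      if h : w ∈ L then x ⟨L.idxOf w + 1, Nat.succ_lt_succ (List.idxOf_lt_length_of_mem h)⟩ else x 0
    have hu (w : PiWit T φ j) (h : w ∈ L) : u (some w) =
        x (Fin.succ ⟨L.idxOf w, List.idxOf_lt_length_of_mem h⟩) := dif_pos h
    have hform (q : Fin L.length) (y : N) : (chainForm hL q).Realize
        (Fin.snoc (fun i => x (Fin.castLE (by omega) i)) y : Fin (q.val + 2) → N) ↔
          L[q].form.Realize (Fin.snoc (Fin.cons (u none) fun i => u (some (L[q].args i)) :
            Fin (L[q].arity + 1) → N) y : Fin (L[q].arity + 2) → N) := by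
      rw [realize_chainForm]
      have henv : (fun i => x (Fin.castLE (by omega) (chainVars hL q i))) =
          (Fin.cons (u none) fun i => u (some (L[q].args i)) : Fin (L[q].arity + 1) → N) := by
        funext i
        refine Fin.cases ?_ (fun i => ?_) i
        · rfl
        · rw [Fin.cons_succ]
          exact (hu _ (List.mem_of_mem_take (hL q q.2 i))).symm
      rw [henv]
    obtain ⟨δ, hδ, hnδ⟩ := hfin N u (Theory.model_union_iff.2 ⟨hB, hT⟩)
    apply hnδ
    have hget (w : PiWit T φ j) (h : w ∈ L) : ∃ q : Fin L.length, L[q] = w ∧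
        u (some w) = x q.succ :=
      ⟨⟨L.idxOf w, List.idxOf_lt_length_of_mem h⟩, List.getElem_idxOf _, hu w h⟩
    -- The failure of the descent formula makes every condition in `Δ` true: `¬φ (x₀)`, the formulas
    -- `θ`, and the absence of smaller solutions among the listed values.
    rcases hΔL hδ with (rfl | ⟨w, hw, rfl⟩) | ⟨w, hw, z, hz, rfl⟩
    · rw [Formula.realize_not, Formula.realize_relabel]
      exact hnφ
    · obtain ⟨q, rfl, hq⟩ := hget w hw
      have h := hθ q
      rw [thetaF, Formula.realize_relabel] at h
      rw [Formula.realize_relabel, comp_witVars, ← hform, hq]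
      convert h using 1
      funext i
      refine Fin.lastCases ?_ (fun i => ?_) i
      · rw [Fin.snoc_last]; rfl
      · rw [Fin.snoc_castSucc]; rfl
    · obtain ⟨q, rfl, hq⟩ := hget w hw
      obtain ⟨l, -, hl⟩ := hget z hz
      rw [Formula.realize_not, Formula.realize_inf, Formula.realize_relabel,
        Formula.realize_relabel, comp_witVars, ← hform, hl]
      rintro ⟨h₁, h₂⟩
      refine hdesc q l ?_ ?_
      · convert h₁ using 1
        funext i
        fin_cases i
        · exact hl.symm
        · exact hq.symm
      · rw [thetaAtF, Formula.realize_relabel]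
        convert h₂ using 1
        funext i
        refine Fin.lastCases ?_ (fun i => ?_) i
        · rw [Fin.snoc_last, Function.comp_apply, Fin.snoc_last]
        · rw [Fin.snoc_castSucc, Function.comp_apply, Fin.snoc_castSucc]

end Main
end BoundedArith

-- The theorem for `Tⁱ₂` and `Sⁱ₂`.

open BoundedArith in
theorem theorem5p5 (i : ℕ) (hi : 0 < i) (T : FirstOrder.Language.Theory BoundedArith.LTC)
    (hT : BoundedArith.IsAxiomatizedBy (BoundedArith.IsAllExSigmaHat i) T)
    (φ : FirstOrder.Language.Formula BoundedArith.LTC (Fin 1))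
    (hφ : BoundedArith.IsExAllPiHat i φ) :
    (BoundedArith.Proves (T ∪ BoundedArith.T2 i) (BoundedArith.univClosure φ) →
      ∃ (k : ℕ) (θ : ∀ j : Fin k, FirstOrder.Language.Formula BoundedArith.LTC (Fin (j.val + 2))),
        (∀ j, BoundedArith.IsPiHat (i - 1) (θ j)) ∧
        (∀ j, BoundedArith.Proves T
          (BoundedArith.univClosure (BoundedArith.totalF φ (θ j)))) ∧
        BoundedArith.Proves T
          (BoundedArith.univClosure (BoundedArith.descentF BoundedArith.ltF φ θ))) ∧
    (BoundedArith.Proves (T ∪ BoundedArith.S2 i) (BoundedArith.univClosure φ) →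
      ∃ (k : ℕ) (θ : ∀ j : Fin k, FirstOrder.Language.Formula BoundedArith.LTC (Fin (j.val + 2))),
        (∀ j, BoundedArith.IsPiHat (i - 1) (θ j)) ∧
        (∀ j, BoundedArith.Proves T
          (BoundedArith.univClosure (BoundedArith.totalF φ (θ j)))) ∧
        BoundedArith.Proves T
          (BoundedArith.univClosure (BoundedArith.descentF BoundedArith.lenLtF φ θ))) := by
  obtain ⟨j, rfl⟩ : ∃ j, i = j + 1 := ⟨i - 1, by omega⟩
  rw [Nat.add_sub_cancel]
  obtain ⟨Γ, hΓ, hTΓ⟩ := hT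
  have hΓT {M : Type} [FirstOrder.Language.Structure LTC M] [Nonempty M] (hB : M ⊨ baseTheory)
      (hM : M ⊨ Γ) : M ⊨ T :=
    ⟨fun σ hσ => ((hTΓ σ).1 (.hyp hσ)).realize M hB hM⟩
  have hTΓ' : ∀ σ ∈ Γ, Proves T σ := fun σ hσ => (hTΓ σ).2 (.hyp hσ)
  constructor
  · intro h
    refine witnessing (ρ := ltF (.var 0) (.var 1)) (isQF_ltF _ _) hΓ hTΓ' hφ
      (fun M _ _ hB hM hmin x => ?_) (fun k => ltF) fun k s t N _ v => ?_
    -- The relation defined by `ltF` is the strict order of the model, so `HasMin.model_T2` provides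
    -- the induction axioms.
    · have hmin' : HasMin M j (linearOrderOf M).lt := by
        intro m Θ hΘ v xs w hw
        obtain ⟨c, hc, hm⟩ := hmin Θ hΘ v xs w hw
        exact ⟨c, hc, fun d hd h => hm d hd (realize_ltF.2 h)⟩
      have := h.realize M hB
        (FirstOrder.Language.Theory.model_union_iff.2 ⟨hΓT hB hM, hmin'.model_T2⟩)
      exact realize_univClosure.1 this _
    · simp [realize_ltF_raw]
  · intro h
    refine witnessing (ρ := lenLtF (.var 0) (.var 1)) (isQF_ltF _ _) hΓ hTΓ' hφ
      (fun M _ _ hB hM hmin x => ?_) (fun k => lenLtF) fun k s t N _ v => ?_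
    · have hmin' : HasMin M j fun d c => (linearOrderOf M).lt (mlen d) (mlen c) := by
        intro m Θ hΘ v xs w hw
        obtain ⟨c, hc, hm⟩ := hmin Θ hΘ v xs w hw
        refine ⟨c, hc, fun d hd h => hm d hd (realize_ltF.2 ?_)⟩
        rwa [realize_len, realize_len]
      have := h.realize M hB
        (FirstOrder.Language.Theory.model_union_iff.2 ⟨hΓT hB hM, hmin'.model_S2⟩)
      exact realize_univClosure.1 this _
    · simp [lenLtF, realize_ltF_raw]
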